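/- Let $n\ge 3$, $l>0$ and $a=e^l>1$. Let $\mathbf H^n=\{p=(w,z): w\in\mathbf R^{n-1},\ z>0\}$ be the upper half-space model of hyperbolic $n$-space, $|p|$ the Euclidean norm, and $V_k$ the volume of the unit sphere $S^k\subset\mathbf R^{k+1}$. Let $Q_a\subset T_1(\mathbf H^n)$ be the set of unit tangent vectors based at points $p$ with $1\le|p|\le a$ that are tangent to a geodesic arc having one endpoint on the hyperbolic plane $\{|p|=1\}$ and the other on the hyperbolic plane $\{|p|=a\}$ (in either order). For a measure $\mu$ on $T_1(\mathbf H^n)$ put $$F_n^{\mu}(l)=\frac{\mu(Q_a)}{V_{n-1}} .$$ Let $\Omega$ be the standard volume measure on $T_1(\mathbf H^n)$ (hyperbolic volume on the base times the standard volume of the unit spheres $S^{n-1}$ in the tangent spaces). Let $\Omega'$ be the measure $$d\Omega'=\frac{2\,dV(x)\,dV(y)\,dt}{|x-y|^{2n-2}},$$ where $(x,y,t)\in\mathbf R^{n-1}\times\mathbf R^{n-1}\times\mathbf R$, $x\ne y$, denotes the unit vector tangent to the geodesic directed from the ideal point $x$ to the ideal point $y$, at signed hyperbolic distance $t$ from the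 highest point of this geodesic, and $dV$ is Lebesgue measure on $\mathbf R^{n-1}$. For $b>1$ let $$M_n(b)=\int_{-1}^{1}du\int_b^\infty \frac{1}{(v-u)^n}\,\log\left(\frac{(v^2-1)(u^2-b^2)}{(v^2-b^2)(u^2-1)}\right)dv .$$ Then $\Omega(Q_a)$ and $\Omega'(Q_a)$ are finite, all the integrals here converge absolutely (the one defining $M_n(b)$ as an integral over $(-1,1)\times(b,\infty)$, for every $b>1$), and $$F_n^{\Omega}(l)=\frac{2^{n-1}V_{n-2}V_{n-3}}{V_{n-1}}\int_0^1\frac{r^{n-3}}{\left(\sqrt{1-r^2}\right)^{n-2}}\,M_n\!\left(\sqrt{\frac{a^2-r^2}{1-r^2}}\right)dr=\frac{2^{n-1}V_{n-2}V_{n-3}}{V_{n-1}}\int_a^\infty\left(\frac{x^2-a^2}{a^2-1}\right)^{\frac n2-2}\frac{x\,M_n(x)}{x^2-1}\,dx ,$$ while with the normalization $\Omega'$ $$F_n^{\Omega'}(l)=\frac{2V_{n-2}V_{n-3}}{V_{n-1}}\int_0^1\frac{r^{n-3}}{\left(\sqrt{1-r^2}\right)^{n-2}}\,M_n\!\left(\sqrt{\frac{a^2-r^2}{1-r^2}}\right)dr=\frac{2V_{n-2}V_{n-3}}{V_{n-1}}\int_a^\infty\left(\frac{x^2-a^2}{a^2-1}\right)^{\frac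 n2-2}\frac{x\,M_n(x)}{x^2-1}\,dx .$$ -/

import Mathlib

open Real Set MeasureTheory
open scoped ENNReal

noncomputable section

namespace Orthospectrum

/-- Euclidean space `ℝⁿ = ℝⁿ⁻¹ × ℝ` (with the Euclidean norm); the upper half-space model of
hyperbolic `n`-space is the set of its points `p` with height `p.snd > 0`. The same space serves
as the tangent space at every point. -/
abbrev Amb (n : ℕ) : Type := WithLp 2 (EuclideanSpace ℝ (Fin (n - 1)) × ℝ)

/-- The hyperbolic geodesic `t ↦ γ t` with `γ 0 = p` and `γ' 0 = v`, where `0 < p.snd` and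
`‖v‖ = p.snd` (that is, `v` has length one for the hyperbolic metric at `p`). It is a vertical
half-line or a half-circle orthogonal to the boundary; `geod_zero`, `hasDerivAt_geod`,
`geod_snd_pos` and `geod_dist` are the facts that single it out. -/
def geod {n : ℕ} (p v : Amb n) (t : ℝ) : Amb n :=
  WithLp.toLp 2
    (p.fst + (sinh t / (cosh t - v.snd / p.snd * sinh t)) • v.fst,
      p.snd / (cosh t - v.snd / p.snd * sinh t))

theorem norm_sq_amb {n : ℕ} (p : Amb n) : ‖p‖ ^ 2 = ‖p.fst‖ ^ 2 + p.snd ^ 2 := by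
  rw [WithLp.prod_norm_sq_eq_of_L2, Real.norm_eq_abs, sq_abs]

theorem geod_denom_pos {n : ℕ} {p v : Amb n} (hp : 0 < p.snd) (hv : ‖v‖ = p.snd) (t : ℝ) :
    0 < cosh t - v.snd / p.snd * sinh t := by
  have h1 := norm_sq_amb v
  have h2 : |v.snd / p.snd| ≤ 1 := by
    rw [abs_div, abs_of_pos hp, div_le_one hp, ← hv]
    refine abs_le_of_sq_le_sq ?_ (norm_nonneg v)
    nlinarith [sq_nonneg ‖v.fst‖]
  have h3 : |sinh t| < cosh t := by
    apply abs_lt_of_sq_lt_sq _ (cosh_pos t).le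
    nlinarith [cosh_sq t]
  have h4 : v.snd / p.snd * sinh t ≤ |sinh t| := by
    calc v.snd / p.snd * sinh t ≤ |v.snd / p.snd * sinh t| := le_abs_self _
      _ = |v.snd / p.snd| * |sinh t| := abs_mul _ _
      _ ≤ 1 * |sinh t| := by gcongr
      _ = |sinh t| := one_mul _
  linarith

theorem geod_snd_pos {n : ℕ} {p v : Amb n} (hp : 0 < p.snd) (hv : ‖v‖ = p.snd) (t : ℝ) :
    0 < (geod p v t).snd :=
  div_pos hp (geod_denom_pos hp hv t)

theorem geod_zero {n : ℕ} (p v : Amb n) : geod p v 0 = p := by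
  simp [geod]
  rfl

theorem hasDerivAt_geod {n : ℕ} {p v : Amb n} (hp : 0 < p.snd) :
    HasDerivAt (fun t => (geod p v t).fst) v.fst 0 ∧
      HasDerivAt (fun t => (geod p v t).snd) v.snd 0 := by
  have hd : HasDerivAt (fun t => cosh t - v.snd / p.snd * sinh t) (-(v.snd / p.snd)) 0 := by
    have := (hasDerivAt_cosh 0).sub ((hasDerivAt_sinh 0).const_mul (v.snd / p.snd))
    exact this.congr_deriv (by simp)
  have h0 : cosh 0 - v.snd / p.snd * sinh 0 ≠ 0 := by simp
  have h1 : HasDerivAt (fun t => sinh t / (cosh t - v.snd / p.snd * sinh t)) 1 0 := by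
    have := (hasDerivAt_sinh 0).div hd h0
    exact this.congr_deriv (by simp)
  have h2 : HasDerivAt (fun t => p.snd / (cosh t - v.snd / p.snd * sinh t)) v.snd 0 := by
    have := (hasDerivAt_const (0 : ℝ) p.snd).div hd h0
    have e : p.snd * (v.snd / p.snd) = v.snd := by field_simp
    exact this.congr_deriv (by simp [e])
  have h3 := (h1.smul_const v.fst).const_add p.fst
  rw [one_smul] at h3
  exact ⟨h3, h2⟩

/-- `geod p v` has unit speed and minimizes distance: the left-hand side is the hyperbolic cosine
of the hyperbolic distance of the two points. -/
theorem geod_dist {n : ℕ} {p v : Amb n} (hp : 0 < p.snd) (hv : ‖v‖ = p.snd) (s t : ℝ) :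
    1 + ‖geod p v s - geod p v t‖ ^ 2 / (2 * (geod p v s).snd * (geod p v t).snd)
      = cosh (s - t) := by
  have hs := geod_denom_pos hp hv s
  have ht := geod_denom_pos hp hv t
  have h1 := norm_sq_amb v
  rw [hv] at h1
  have h2 : (geod p v s - geod p v t).fst
      = (sinh s / (cosh s - v.snd / p.snd * sinh s)
        - sinh t / (cosh t - v.snd / p.snd * sinh t)) • v.fst := by
    simp [geod, sub_smul]
  have h3 : (geod p v s - geod p v t).snd
      = p.snd / (cosh s - v.snd / p.snd * sinh s)
        - p.snd / (cosh t - v.snd / p.snd * sinh t) := by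
    simp [geod]
  have h4 : ‖v.fst‖ ^ 2 = p.snd ^ 2 * (1 - (v.snd / p.snd) ^ 2) := by
    field_simp
    linarith
  rw [norm_sq_amb, h2, h3, norm_smul, mul_pow, Real.norm_eq_abs, sq_abs, h4]
  simp only [geod]
  rw [cosh_sub]
  have key : ∀ c z C S C' S' : ℝ, 0 < z → C ^ 2 = S ^ 2 + 1 → C' ^ 2 = S' ^ 2 + 1 →
      0 < C - c * S → 0 < C' - c * S' →
      1 + ((S / (C - c * S) - S' / (C' - c * S')) ^ 2 * (z ^ 2 * (1 - c ^ 2))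
        + (z / (C - c * S) - z / (C' - c * S')) ^ 2)
          / (2 * (z / (C - c * S)) * (z / (C' - c * S'))) = C * C' - S * S' := by
    intro c z C S C' S' hz e e' h h'
    have e1 := h.ne'
    have e2 := h'.ne'
    field_simp
    grind
  exact key _ _ _ _ _ _ hp (cosh_sq s) (cosh_sq t) hs ht

/-- The volume `V_k` of the unit sphere `S^k ⊆ ℝ^(k+1)`. -/
def sphereVol (k : ℕ) : ℝ :=
  (volume : Measure (EuclideanSpace ℝ (Fin (k + 1)))).toSphere.real univ

/-- The hyperbolic volume measure of the upper half-space. -/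
def hypVolume (n : ℕ) : Measure (Amb n) :=
  (volume.restrict {p : Amb n | 0 < p.snd}).withDensity fun p => ENNReal.ofReal (1 / p.snd ^ n)

/-- The standard (Riemannian, Liouville) volume measure `Ω` on the unit tangent bundle of
hyperbolic `n`-space: the hyperbolic volume on the base times the standard volume of the unit
spheres of the tangent spaces. Tangent vectors are pairs `(p, v)`; the unit vectors at `p` are
`v = p.snd • w` with `w` in the Euclidean unit sphere. -/
def unitTangentVolume (n : ℕ) : Measure (Amb n × Amb n) :=
  ((hypVolume n).prod (volume : Measure (Amb n)).toSphere).map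
    fun q => (q.1, q.1.snd • (q.2 : Amb n))

/-- The unit tangent vector with coordinates `(x, y, t)`: it is tangent to the geodesic directed
from the ideal point `x` to the ideal point `y` (a half-circle), at the point with signed hyperbolic
distance `t` from the highest point of that geodesic. -/
def endpointVector {n : ℕ}
    (q : EuclideanSpace ℝ (Fin (n - 1)) × EuclideanSpace ℝ (Fin (n - 1)) × ℝ) : Amb n × Amb n :=
  (WithLp.toLp 2
    ((1 / 2 : ℝ) • (q.1 + q.2.1) + (tanh q.2.2 / 2) • (q.2.1 - q.1),
      ‖q.2.1 - q.1‖ / (2 * cosh q.2.2)),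
    WithLp.toLp 2
    ((1 / (2 * cosh q.2.2 ^ 2)) • (q.2.1 - q.1),
      -(‖q.2.1 - q.1‖ * sinh q.2.2 / (2 * cosh q.2.2 ^ 2))))

theorem norm_endpointVector {n : ℕ} (x y : EuclideanSpace ℝ (Fin (n - 1))) (t : ℝ) :
    ‖(endpointVector (x, y, t)).2‖ = (endpointVector (x, y, t)).1.snd := by
  have hc := cosh_pos t
  rw [← sq_eq_sq₀ (norm_nonneg _) (by simp only [endpointVector, WithLp.toLp_snd]; positivity), norm_sq_amb]
  simp only [endpointVector, WithLp.toLp_fst, WithLp.toLp_snd]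
  rw [norm_smul, mul_pow, Real.norm_eq_abs, sq_abs]
  have e := cosh_sq t
  field_simp
  rw [e]
  ring

/-- Moving along the geodesic changes only the coordinate `t`. -/
theorem geod_endpointVector {n : ℕ} {x y : EuclideanSpace ℝ (Fin (n - 1))} (h : x ≠ y)
    (t s : ℝ) :
    geod (endpointVector (x, y, t)).1 (endpointVector (x, y, t)).2 s
      = (endpointVector (x, y, t + s)).1 := by
  have hn : 0 < ‖y - x‖ := norm_pos_iff.mpr (sub_ne_zero.mpr h.symm)
  have hc := cosh_pos t
  have hc' := cosh_pos (t + s)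
  have hd : cosh s - (endpointVector (x, y, t)).2.snd / (endpointVector (x, y, t)).1.snd * sinh s
      = cosh (t + s) / cosh t := by
    simp only [endpointVector, WithLp.toLp_snd]
    rw [cosh_add]
    field_simp
    ring
  unfold geod
  rw [hd]
  simp only [endpointVector, WithLp.toLp_fst, WithLp.toLp_snd]
  congr 2
  · rw [add_assoc, smul_smul, ← add_smul]
    congr 2
    rw [tanh_eq_sinh_div_cosh, tanh_eq_sinh_div_cosh]
    have e : sinh s = sinh (t + s) * cosh t - cosh (t + s) * sinh t := by
      rw [← sinh_sub]; ring_nf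
    rw [e]
    have e2 := cosh_sq t
    field_simp
    ring
  · field_simp

/-- The measure `2 dV(x) dV(y) dt / |x - y|^(2n-2)` on the unit tangent bundle, in the coordinates
`(x, y, t)` of `endpointVector`. -/
def endpointVolume (n : ℕ) : Measure (Amb n × Amb n) :=
  ((volume : Measure (EuclideanSpace ℝ (Fin (n - 1)) × EuclideanSpace ℝ (Fin (n - 1)) × ℝ)
    ).withDensity fun q => ENNReal.ofReal (2 / ‖q.1 - q.2.1‖ ^ (2 * n - 2))).map endpointVector

/-- The set `Q_a` of unit tangent vectors based in the closed region between the hyperbolic planes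
`‖p‖ = 1` and `‖p‖ = a` which are tangent to a geodesic arc with one endpoint on each of the two
planes (in either order). -/
def crossing (n : ℕ) (a : ℝ) : Set (Amb n × Amb n) :=
  {q | 0 < q.1.snd ∧ ‖q.2‖ = q.1.snd ∧ 1 ≤ ‖q.1‖ ∧ ‖q.1‖ ≤ a ∧
    ∃ s t : ℝ, s ≤ 0 ∧ 0 ≤ t ∧
      ((‖geod q.1 q.2 s‖ = 1 ∧ ‖geod q.1 q.2 t‖ = a) ∨
        (‖geod q.1 q.2 s‖ = a ∧ ‖geod q.1 q.2 t‖ = 1))}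

/-- `F_n(l) = μ(Q_a) / V_{n-1}` with `a = e^l`, for a measure `μ` on the unit tangent bundle. -/
def orthoF (n : ℕ) (μ : Measure (Amb n × Amb n)) (l : ℝ) : ℝ :=
  (μ (crossing n (exp l))).toReal / sphereVol (n - 1)

/-- The integrand of `M_n(b)`. -/
def kernelM (n : ℕ) (b u v : ℝ) : ℝ :=
  log (((v ^ 2 - 1) * (u ^ 2 - b ^ 2)) / ((v ^ 2 - b ^ 2) * (u ^ 2 - 1))) / (v - u) ^ n

/-- `M_n(b) = ∫_{-1}^1 du ∫_b^∞ dv` of `kernelM`. -/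
def M (n : ℕ) (b : ℝ) : ℝ :=
  ∫ u in (-1 : ℝ)..1, ∫ v in Ioi b, kernelM n b u v

/-- The integrand over `0 < r < 1`. -/
def integrandR (n : ℕ) (a r : ℝ) : ℝ :=
  r ^ (n - 3) / √(1 - r ^ 2) ^ (n - 2) * M n √((a ^ 2 - r ^ 2) / (1 - r ^ 2))

/-- The integrand over `a < x < ∞`. -/
def integrandX (n : ℕ) (a x : ℝ) : ℝ :=
  ((x ^ 2 - a ^ 2) / (a ^ 2 - 1)) ^ ((n : ℝ) / 2 - 2) * (x * M n x / (x ^ 2 - 1))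

end Orthospectrum

end

noncomputable section

namespace Orthospectrum

/-! The theorem compares two descriptions of a unit tangent vector and then integrates over
geodesics.

In endpoint coordinates, `Ω` is a constant multiple of `Ω'`. Parametrize the unit sphere of
directions by `(sech t • e, -tanh t)`, where `e` is a horizontal unit vector. Then `t` is the signed
distance from the top of the geodesic, and the base point has height `ρ / (2 cosh t)` with `ρ` the
distance of the endpoints. After this rescaling all powers of `cosh t` cancel, and `Ω = 2^(n-2) Ω'`
(`unitTangentVolume_eq`). Hence only `Ω'` has to be computed.

Along a geodesic, `‖γ‖²` is the average of `‖x‖²` and `‖y‖²` with weights `e^(-t)` and `e^t`, a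
monotone function of `t`. So the geodesic joins the two planes exactly when one endpoint has norm `<
1` and the other norm `> a`, and the admissible `t` form an interval whose length is half a
logarithm (`endpointVector_mem_crossing_iff`, `volume_arc`). The two orientations contribute equally
(`endpointVolume_crossing`).

What remains depends on `x`, `y` only through their norms and distance. Sort the pairs by the line
through them: its direction contributes `V_(n-2)`, the direction of its foot `V_(n-3)`, and its
distance `r` to the origin the weight `r^(n-3)` (`lintegral_pair_eq_lintegral_line`). On a line with
`r < 1`, rescaling by `√(1 - r²)` turns the two spheres into `±1` and `±b` with `b² = (a² - r²) / (1
- r²)`, and the integral becomes `M_n(b)` (`lintegral_line_eq`).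

These identities hold in `[0, ∞]`. Finiteness follows from a bound `M_n(b) ≤ K / b^(n-2)` uniform in
`b ≥ a` (`exists_lintegralM_le`), and the integral over `x` from the substitution `x = b(r)`. -/

@[fun_prop]
theorem measurable_tanh : Measurable tanh := by
  have : tanh = fun x => sinh x / cosh x := funext tanh_eq_sinh_div_cosh
  rw [this]
  fun_prop

/-! ### Polar coordinates, one-variable substitutions and the measure of the unit sphere -/

section Polar

variable {E : Type*} [NormedAddCommGroup E] [InnerProductSpace ℝ E] [FiniteDimensional ℝ E]
  [MeasurableSpace E] [BorelSpace E]

/-- Integration in polar coordinates. -/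
theorem lintegral_polar {d : ℕ} (hd : Module.finrank ℝ E = d + 1) {f : E → ℝ≥0∞}
    (hf : Measurable f) :
    ∫⁻ x, f x = ∫⁻ e : Metric.sphere (0 : E) 1, (∫⁻ ρ in Ioi (0 : ℝ),
      ENNReal.ofReal (ρ ^ d) * f (ρ • (e : E))) ∂(volume : Measure E).toSphere := by
  have : Nontrivial E := Module.nontrivial_of_finrank_pos (R := ℝ) (by omega)
  have hmp := (volume : Measure E).measurePreserving_homeomorphUnitSphereProd
  have hd' : Module.finrank ℝ E - 1 = d := by omega
  rw [hd'] at hmp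
  have h1 : ∫⁻ x, f x = ∫⁻ x : ({0}ᶜ : Set E), f (x : E) ∂(volume.comap (Subtype.val : ({0}ᶜ : Set E) → E)) := by
    rw [lintegral_subtype_comap (measurableSet_singleton _).compl, restrict_compl_singleton]
  have h2 : ∀ x : ({0}ᶜ : Set E), f (x : E) = (fun q : Metric.sphere (0 : E) 1 × Ioi (0 : ℝ) =>
      f (q.2.1 • (q.1 : E))) (homeomorphUnitSphereProd E x) := by
    intro x
    have h0 : ‖(x : E)‖ ≠ 0 := norm_ne_zero_iff.2 x.2
    simp [smul_smul, h0]
  have hm : Measurable fun q : Metric.sphere (0 : E) 1 × Ioi (0 : ℝ) => f (q.2.1 • (q.1 : E)) := by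
    fun_prop
  rw [h1, lintegral_congr h2, hmp.lintegral_comp hm, lintegral_prod _ hm.aemeasurable]
  refine lintegral_congr fun e => ?_
  rw [Measure.volumeIoiPow, lintegral_withDensity_eq_lintegral_mul _ (by fun_prop) (by fun_prop)]
  exact lintegral_subtype_comap measurableSet_Ioi
    fun ρ : ℝ => ENNReal.ofReal (ρ ^ d) * f (ρ • (e : E))

end Polar

/-- A linear change of variable on a half-line. -/
theorem lintegral_Ioi_comp_mul_left {c : ℝ} (hc : 0 < c) (f : ℝ → ℝ≥0∞) (b : ℝ) :
    ∫⁻ x in Ioi (c * b), f x = ∫⁻ x in Ioi b, ENNReal.ofReal c * f (c * x) := by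
  have him : (fun x => c * x) '' Ioi b = Ioi (c * b) := by
    simpa using Set.image_mul_left_Ioi hc b
  have := lintegral_image_eq_lintegral_abs_deriv_mul (s := Ioi b) measurableSet_Ioi
    (f := fun x => c * x) (f' := fun _ => c)
    (fun x _ => (hasDerivAt_const_mul c).hasDerivWithinAt)
    (mul_right_injective₀ hc.ne').injOn f
  rw [him, abs_of_pos hc] at this
  exact this

theorem lintegral_Ioi_zero_comp_mul_left {c : ℝ} (hc : 0 < c) (f : ℝ → ℝ≥0∞) :
    ∫⁻ x in Ioi 0, f x = ∫⁻ x in Ioi 0, ENNReal.ofReal c * f (c * x) := by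
  simpa using lintegral_Ioi_comp_mul_left hc f 0

theorem lintegral_comp_mul_left {c : ℝ} (hc : 0 < c) (f : ℝ → ℝ≥0∞) :
    ∫⁻ x, f x = ∫⁻ x, ENNReal.ofReal c * f (c * x) := by
  have him : (fun x => c * x) '' univ = univ :=
    image_univ_of_surjective (mul_left_surjective₀ hc.ne')
  have := lintegral_image_eq_lintegral_abs_deriv_mul (s := univ) MeasurableSet.univ
    (f := fun x => c * x) (f' := fun _ => c)
    (fun x _ => (hasDerivAt_const_mul c).hasDerivWithinAt)
    (mul_right_injective₀ hc.ne').injOn f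
  rw [him, abs_of_pos hc] at this
  simpa using this

/-- The substitution `h = -κ sinh t`. -/
theorem lintegral_eq_lintegral_sinh {κ : ℝ} (hκ : 0 < κ) (f : ℝ → ℝ≥0∞) :
    ∫⁻ h, f h = ∫⁻ t, ENNReal.ofReal (κ * cosh t) * f (-(κ * sinh t)) := by
  have hsurj : Function.Surjective fun t => -(κ * sinh t) := fun h =>
    ⟨arsinh (-h / κ), by simp only [sinh_arsinh]; field_simp⟩
  have := lintegral_image_eq_lintegral_abs_deriv_mul (s := univ) MeasurableSet.univ
    (f := fun t => -(κ * sinh t)) (f' := fun t => -(κ * cosh t))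
    (fun x _ => ((hasDerivAt_sinh x).const_mul κ).neg.hasDerivWithinAt)
    (fun s _ t _ h => by simpa [hκ.ne'] using h) f
  rw [image_univ_of_surjective hsurj] at this
  have e : ∀ t, |-(κ * cosh t)| = κ * cosh t := fun t => by
    rw [abs_neg, abs_of_pos (mul_pos hκ (cosh_pos t))]
  simpa [e] using this

theorem finrank_withLp_prod_real {E : Type*} [NormedAddCommGroup E] [InnerProductSpace ℝ E]
    [FiniteDimensional ℝ E] :
    Module.finrank ℝ (WithLp 2 (E × ℝ)) = Module.finrank ℝ E + 1 := by
  rw [(WithLp.linearEquiv 2 ℝ (E × ℝ)).finrank_eq, Module.finrank_prod, Module.finrank_self]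

theorem norm_toLp_smul_sinh {E : Type*} [NormedAddCommGroup E] [InnerProductSpace ℝ E]
    (e : Metric.sphere (0 : E) 1) {κ : ℝ} (hκ : 0 < κ) (t : ℝ) :
    ‖WithLp.toLp 2 (κ • (e : E), -(κ * sinh t))‖ = κ * cosh t := by
  have he : ‖(e : E)‖ = 1 := by simp
  rw [WithLp.prod_norm_eq_of_L2, Real.sqrt_eq_iff_eq_sq (by positivity)
    (mul_pos hκ (cosh_pos t)).le]
  simp only [WithLp.toLp_fst, WithLp.toLp_snd, norm_smul, he, Real.norm_eq_abs, mul_pow, sq_abs,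
    neg_sq, cosh_sq]
  ring

theorem lintegral_Ioo_pow_ne (d : ℕ) : ∫⁻ ρ in Ioi (0 : ℝ), (Iio 1).indicator
      (fun ρ => ENNReal.ofReal (ρ ^ d)) ρ ≠ 0 ∧
    ∫⁻ ρ in Ioi (0 : ℝ), (Iio 1).indicator (fun ρ => ENNReal.ofReal (ρ ^ d)) ρ ≠ ⊤ := by
  rw [lintegral_indicator measurableSet_Iio, Measure.restrict_restrict measurableSet_Iio,
    inter_comm, Ioi_inter_Iio]
  constructor
  · refine ne_of_gt ((setLIntegral_pos_iff (by fun_prop)).2 ?_)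
    rw [inter_eq_right.2]
    · simp
    · intro ρ hρ
      simpa using pow_pos hρ.1 d
  · refine ne_top_of_le_ne_top (b := ∫⁻ ρ in Ioo (0 : ℝ) 1, 1) (by simp) ?_
    refine setLIntegral_mono measurable_const fun ρ hρ => ?_
    rw [← ENNReal.ofReal_one]
    exact ENNReal.ofReal_le_ofReal (pow_le_one₀ hρ.1.le hρ.2.le)

section Sphere

variable {E : Type*} [NormedAddCommGroup E] [InnerProductSpace ℝ E] [FiniteDimensional ℝ E]
  [MeasurableSpace E] [BorelSpace E]

theorem lintegral_withLp_prod {f : WithLp 2 (E × ℝ) → ℝ≥0∞} (hf : Measurable f) :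
    ∫⁻ p, f p = ∫⁻ x : E, ∫⁻ h : ℝ, f (WithLp.toLp 2 (x, h)) := by
  have hm : Measurable fun q : E × ℝ => f (WithLp.toLp 2 q) :=
    hf.comp (WithLp.measurable_toLp 2 _)
  rw [← (WithLp.volume_preserving_toLp E ℝ).lintegral_comp hf, Measure.volume_eq_prod,
    lintegral_prod _ hm.aemeasurable]

/-- The volume measure of the unit sphere of `E × ℝ` in cylindrical coordinates. -/
theorem lintegral_sphere_withLp_prod {d : ℕ} (hd : Module.finrank ℝ E = d + 1)
    {g : WithLp 2 (E × ℝ) → ℝ≥0∞} (hg : Measurable g) :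
    ∫⁻ w : Metric.sphere (0 : WithLp 2 (E × ℝ)) 1, g w
        ∂(volume : Measure (WithLp 2 (E × ℝ))).toSphere
      = ∫⁻ e : Metric.sphere (0 : E) 1, (∫⁻ t : ℝ, ENNReal.ofReal ((cosh t)⁻¹ ^ (d + 1)) *
          g (WithLp.toLp 2 ((cosh t)⁻¹ • (e : E), -tanh t))) ∂(volume : Measure E).toSphere := by
  -- The function `g` is extended to the unit ball, constant along rays, and the ball integral is
  -- computed twice: in polar coordinates of `E × ℝ`, and in polar coordinates of `E` with `h = -κ
  -- sinh t`, `κ = ρ / cosh t`. Both give the desired side times the radial constant `c`, which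
  -- cancels because it is neither `0` nor `∞`.
  set c := ∫⁻ ρ in Ioi (0 : ℝ), (Iio 1).indicator (fun ρ => ENNReal.ofReal (ρ ^ (d + 1))) ρ
    with hc
  obtain ⟨hc0, hct⟩ := lintegral_Ioo_pow_ne (d + 1)
  rw [← hc] at hc0 hct
  set H : WithLp 2 (E × ℝ) → ℝ≥0∞ :=
    (Metric.ball 0 1).indicator fun v => g (‖v‖⁻¹ • v) with hH
  have hHm : Measurable H :=
    (hg.comp (by fun_prop)).indicator Metric.isOpen_ball.measurableSet
  have hcm : Measurable ((Iio (1 : ℝ)).indicator fun ρ => ENNReal.ofReal (ρ ^ (d + 1))) :=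
    (by fun_prop : Measurable fun ρ : ℝ => ENNReal.ofReal (ρ ^ (d + 1))).indicator
      measurableSet_Iio
  have e1 : ∫⁻ v, H v = (∫⁻ w : Metric.sphere (0 : WithLp 2 (E × ℝ)) 1, g w
        ∂(volume : Measure (WithLp 2 (E × ℝ))).toSphere) * c := by
    rw [lintegral_polar (d := d + 1) (by rw [finrank_withLp_prod_real, hd]) hHm,
      ← lintegral_mul_const _ (by fun_prop)]
    refine lintegral_congr fun w => ?_
    rw [hc, ← lintegral_const_mul _ hcm]
    refine setLIntegral_congr_fun measurableSet_Ioi fun ρ hρ => ?_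
    have hρ : 0 < ρ := hρ
    have hw : ‖(w : WithLp 2 (E × ℝ))‖ = 1 := by simp
    have hn : ‖ρ • (w : WithLp 2 (E × ℝ))‖ = ρ := by rw [norm_smul, hw, norm_of_nonneg hρ.le, mul_one]
    by_cases h : ρ < 1
    · simp [hH, hn, indicator, h, smul_smul, hρ.ne', mul_comm]
    · simp [hH, hn, indicator, h]
  have e2 : ∫⁻ v, H v = (∫⁻ e : Metric.sphere (0 : E) 1,
      (∫⁻ t : ℝ, ENNReal.ofReal ((cosh t)⁻¹ ^ (d + 1)) *
        g (WithLp.toLp 2 ((cosh t)⁻¹ • (e : E), -tanh t))) ∂(volume : Measure E).toSphere) * c := by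
    have hgm : Measurable fun q : Metric.sphere (0 : E) 1 × ℝ =>
        ENNReal.ofReal ((cosh q.2)⁻¹ ^ (d + 1)) *
          g (WithLp.toLp 2 ((cosh q.2)⁻¹ • (q.1 : E), -tanh q.2)) := by
      fun_prop
    rw [lintegral_withLp_prod hHm, lintegral_polar hd (Measurable.lintegral_prod_right'
        (f := fun q : E × ℝ => H (WithLp.toLp 2 q)) (hHm.comp (WithLp.measurable_toLp 2 _))),
      ← lintegral_mul_const _ hgm.lintegral_prod_right']
    refine lintegral_congr fun e => ?_
    have hm : Measurable fun q : ℝ × ℝ => ENNReal.ofReal (q.1 ^ d) *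
        (ENNReal.ofReal (q.1 * cosh q.2) *
          H (WithLp.toLp 2 (q.1 • (e : E), -(q.1 * sinh q.2)))) := by
      fun_prop
    calc
      _ = ∫⁻ κ in Ioi (0 : ℝ), ∫⁻ t : ℝ, ENNReal.ofReal (κ ^ d) *
            (ENNReal.ofReal (κ * cosh t) *
              H (WithLp.toLp 2 (κ • (e : E), -(κ * sinh t)))) := by
        refine setLIntegral_congr_fun measurableSet_Ioi fun κ hκ => ?_
        rw [lintegral_eq_lintegral_sinh hκ, lintegral_const_mul _ (by fun_prop)]
      _ = ∫⁻ t : ℝ, ∫⁻ κ in Ioi (0 : ℝ), ENNReal.ofReal (κ ^ d) *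
            (ENNReal.ofReal (κ * cosh t) *
              H (WithLp.toLp 2 (κ • (e : E), -(κ * sinh t)))) :=
        lintegral_lintegral_swap hm.aemeasurable
      _ = _ := by
        have hge : Measurable fun t : ℝ => ENNReal.ofReal ((cosh t)⁻¹ ^ (d + 1)) *
            g (WithLp.toLp 2 ((cosh t)⁻¹ • (e : E), -tanh t)) := by fun_prop
        rw [← lintegral_mul_const c hge]
        refine lintegral_congr fun t => ?_
        have ht := cosh_pos t
        rw [lintegral_Ioi_zero_comp_mul_left (inv_pos.2 ht), hc,
          ← lintegral_const_mul _ hcm]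
        refine setLIntegral_congr_fun measurableSet_Ioi fun ρ hρ => ?_
        have hρ : 0 < ρ := hρ
        have hn := norm_toLp_smul_sinh e (mul_pos (inv_pos.2 ht) hρ) t
        rw [show (cosh t)⁻¹ * ρ * cosh t = ρ by field_simp] at hn
        by_cases h : ρ < 1
        · have hv : ρ⁻¹ • WithLp.toLp 2 (((cosh t)⁻¹ * ρ) • (e : E), -((cosh t)⁻¹ * ρ * sinh t))
              = WithLp.toLp 2 ((cosh t)⁻¹ • (e : E), -tanh t) := by
            rw [← WithLp.toLp_smul, Prod.smul_mk, smul_smul, smul_eq_mul, tanh_eq_sinh_div_cosh]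
            congr 3 <;> field_simp
          have : H (WithLp.toLp 2 (((cosh t)⁻¹ * ρ) • (e : E), -((cosh t)⁻¹ * ρ * sinh t)))
              = g (WithLp.toLp 2 ((cosh t)⁻¹ • (e : E), -tanh t)) := by
            rw [hH, indicator_of_mem (by simpa [hn] using h)]
            rw [hn, hv]
          rw [this, indicator_of_mem (show ρ ∈ Iio (1:ℝ) from h),
            mul_right_comm (ENNReal.ofReal ((cosh t)⁻¹ ^ (d + 1))),
            ← mul_assoc, ← mul_assoc, ← ENNReal.ofReal_mul (by positivity),
            ← ENNReal.ofReal_mul (by positivity), ← ENNReal.ofReal_mul (by positivity)]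
          congr 2
          rw [show (cosh t)⁻¹ * ρ * cosh t = ρ by field_simp, mul_pow, pow_succ, pow_succ]
          ring
        · have : H (WithLp.toLp 2 (((cosh t)⁻¹ * ρ) • (e : E), -((cosh t)⁻¹ * ρ * sinh t))) = 0 := by
            rw [hH, indicator_of_notMem (by simpa [hn] using h)]
          rw [this, indicator_of_notMem (show ρ ∉ Iio (1:ℝ) from h)]
          simp
  exact (ENNReal.mul_left_inj hc0 hct).1 (e1.symm.trans e2)

end Sphere

/-! ### The Liouville measure in endpoint coordinates -/

/-- Integration over pairs of points, in polar coordinates for their difference. -/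
theorem lintegral_pair_polar {E : Type*} [NormedAddCommGroup E] [InnerProductSpace ℝ E]
    [FiniteDimensional ℝ E] [MeasurableSpace E] [BorelSpace E] {d : ℕ}
    (hd : Module.finrank ℝ E = d + 1) {f : E × E → ℝ≥0∞} (hf : Measurable f) :
    ∫⁻ x, ∫⁻ y, f (x, y) = ∫⁻ e : Metric.sphere (0 : E) 1, (∫⁻ ρ in Ioi (0 : ℝ),
      ENNReal.ofReal (ρ ^ d) * ∫⁻ x, f (x, x + ρ • (e : E))) ∂(volume : Measure E).toSphere := by
  have hm : Measurable fun q : E × E => f (q.2, q.2 + q.1) := by fun_prop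
  calc ∫⁻ x, ∫⁻ y, f (x, y) = ∫⁻ x, ∫⁻ y, f (x, x + y) :=
        lintegral_congr fun x => (lintegral_add_left_eq_self (fun y => f (x, y)) x).symm
    _ = ∫⁻ y, ∫⁻ x, f (x, x + y) :=
        lintegral_lintegral_swap (by fun_prop)
    _ = _ := lintegral_polar hd hm.lintegral_prod_right'

@[fun_prop]
theorem measurable_endpointVector {n : ℕ} : Measurable (endpointVector (n := n)) := by
  unfold endpointVector
  fun_prop

theorem lintegral_hypVolume {n : ℕ} {f : Amb n → ℝ≥0∞} (hf : Measurable f) :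
    ∫⁻ p, f p ∂(hypVolume n) = ∫⁻ q : EuclideanSpace ℝ (Fin (n - 1)), ∫⁻ z in Ioi (0 : ℝ),
      ENNReal.ofReal (1 / z ^ n) * f (WithLp.toLp 2 (q, z)) := by
  have hs : MeasurableSet {p : Amb n | 0 < p.snd} :=
    measurableSet_lt measurable_const (by fun_prop)
  rw [hypVolume, lintegral_withDensity_eq_lintegral_mul _ (by fun_prop) hf,
    ← lintegral_indicator hs, lintegral_withLp_prod ((by fun_prop :
      Measurable _).indicator hs)]
  refine lintegral_congr fun q => ?_
  rw [← lintegral_indicator measurableSet_Ioi]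
  refine lintegral_congr fun z => ?_
  by_cases hz : 0 < z <;> simp [indicator, hz]

theorem lintegral_unitTangentVolume {n : ℕ} {F : Amb n × Amb n → ℝ≥0∞} (hF : Measurable F) :
    ∫⁻ q, F q ∂(unitTangentVolume n) = ∫⁻ p, (∫⁻ w : Metric.sphere (0 : Amb n) 1,
      F (p, p.snd • (w : Amb n)) ∂(volume : Measure (Amb n)).toSphere) ∂(hypVolume n) := by
  have : SFinite (hypVolume n) := by unfold hypVolume; infer_instance
  have hm : Measurable fun q : Amb n × Metric.sphere (0 : Amb n) 1 =>
    (q.1, q.1.snd • (q.2 : Amb n)) := by fun_prop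
  rw [unitTangentVolume, lintegral_map hF hm, lintegral_prod _ (by fun_prop)]

theorem lintegral_endpointVolume {n : ℕ} {F : Amb n × Amb n → ℝ≥0∞} (hF : Measurable F) :
    ∫⁻ q, F q ∂(endpointVolume n) = ∫⁻ x : EuclideanSpace ℝ (Fin (n - 1)),
      ∫⁻ y : EuclideanSpace ℝ (Fin (n - 1)), ∫⁻ t : ℝ,
        ENNReal.ofReal (2 / ‖x - y‖ ^ (2 * n - 2)) * F (endpointVector (x, y, t)) := by
  have hm : Measurable fun q : EuclideanSpace ℝ (Fin (n - 1)) ×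
      EuclideanSpace ℝ (Fin (n - 1)) × ℝ =>
      ENNReal.ofReal (2 / ‖q.1 - q.2.1‖ ^ (2 * n - 2)) * F (endpointVector q) := by fun_prop
  rw [endpointVolume, lintegral_map hF measurable_endpointVector,
    lintegral_withDensity_eq_lintegral_mul _ (by fun_prop)
    (by fun_prop : Measurable fun q => F (endpointVector q)), Measure.volume_eq_prod]
  refine (lintegral_prod _ hm.aemeasurable).trans ?_
  refine lintegral_congr fun x => ?_
  exact lintegral_prod _ (hm.comp (measurable_prodMk_left (x := x))).aemeasurable

/-- The boundary at infinity, without its point at infinity. -/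
abbrev Bdry (n : ℕ) : Type := EuclideanSpace ℝ (Fin (n - 1))

/-- This and `lintegral_endpointVolume_eq_aux` put both measures into the same order of integration
(`e`, `t`, a radial variable, a horizontal translation), so that they can be compared integrand by
integrand. The `t` of the sphere parametrization is already the `t` of `endpointVector`. -/
theorem lintegral_unitTangentVolume_eq_aux {n d : ℕ} (hd : Module.finrank ℝ (Bdry n) = d + 1)
    {F : Amb n × Amb n → ℝ≥0∞} (hF : Measurable F) :
    ∫⁻ q, F q ∂(unitTangentVolume n) = ∫⁻ e : Metric.sphere (0 : Bdry n) 1, (∫⁻ t : ℝ,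
      ∫⁻ z in Ioi (0 : ℝ), ∫⁻ x : Bdry n, ENNReal.ofReal (1 / z ^ n * (cosh t)⁻¹ ^ (d + 1)) *
        F (WithLp.toLp 2 (x, z), z • WithLp.toLp 2 ((cosh t)⁻¹ • (e : Bdry n), -tanh t)))
      ∂(volume : Measure (Bdry n)).toSphere := by
  have : SFinite (hypVolume n) := by unfold hypVolume; infer_instance
  rw [lintegral_unitTangentVolume hF]
  calc
    _ = ∫⁻ p, (∫⁻ e : Metric.sphere (0 : Bdry n) 1, (∫⁻ t : ℝ,
          ENNReal.ofReal ((cosh t)⁻¹ ^ (d + 1)) *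
            F (p, p.snd • WithLp.toLp 2 ((cosh t)⁻¹ • (e : Bdry n), -tanh t)))
            ∂(volume : Measure (Bdry n)).toSphere) ∂(hypVolume n) := by
      refine lintegral_congr fun p => ?_
      exact lintegral_sphere_withLp_prod hd (g := fun w => F (p, p.snd • w)) (by fun_prop)
    _ = ∫⁻ e : Metric.sphere (0 : Bdry n) 1, (∫⁻ p, (∫⁻ t : ℝ,
          ENNReal.ofReal ((cosh t)⁻¹ ^ (d + 1)) *
            F (p, p.snd • WithLp.toLp 2 ((cosh t)⁻¹ • (e : Bdry n), -tanh t)))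
            ∂(hypVolume n)) ∂(volume : Measure (Bdry n)).toSphere := by
      refine lintegral_lintegral_swap (Measurable.aemeasurable ?_)
      exact Measurable.lintegral_prod_right' (f := fun q : (Amb n × Metric.sphere (0 : Bdry n) 1) × ℝ
        => ENNReal.ofReal ((cosh q.2)⁻¹ ^ (d + 1)) * F (q.1.1, q.1.1.snd • WithLp.toLp 2
          ((cosh q.2)⁻¹ • (q.1.2 : Bdry n), -tanh q.2))) (by fun_prop)
    _ = _ := by
      refine lintegral_congr fun e => ?_
      rw [lintegral_lintegral_swap (by fun_prop)]
      refine lintegral_congr fun t => ?_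
      rw [lintegral_hypVolume (by fun_prop), lintegral_lintegral_swap (by fun_prop)]
      refine setLIntegral_congr_fun measurableSet_Ioi fun z (hz : 0 < z) => ?_
      refine lintegral_congr fun x => ?_
      rw [ENNReal.ofReal_mul (by positivity), mul_assoc]
      rfl

theorem lintegral_endpointVolume_eq_aux {n d : ℕ} (hd : Module.finrank ℝ (Bdry n) = d + 1)
    {F : Amb n × Amb n → ℝ≥0∞} (hF : Measurable F) :
    ∫⁻ q, F q ∂(endpointVolume n) = ∫⁻ e : Metric.sphere (0 : Bdry n) 1, (∫⁻ t : ℝ,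
      ∫⁻ ρ in Ioi (0 : ℝ), ∫⁻ x : Bdry n, ENNReal.ofReal (ρ ^ d * (2 / ρ ^ (2 * n - 2))) *
        F (endpointVector (x, x + ρ • (e : Bdry n), t)))
      ∂(volume : Measure (Bdry n)).toSphere := by
  have hm : Measurable fun q : (Bdry n × Bdry n) × ℝ =>
      ENNReal.ofReal (2 / ‖q.1.1 - q.1.2‖ ^ (2 * n - 2)) *
        F (endpointVector (q.1.1, q.1.2, q.2)) := by fun_prop
  rw [lintegral_endpointVolume hF]
  refine (lintegral_pair_polar hd hm.lintegral_prod_right').trans ?_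
  refine lintegral_congr fun e => ?_
  have he : ‖(e : Bdry n)‖ = 1 := by simp
  rw [lintegral_lintegral_swap (Measurable.aemeasurable (Measurable.lintegral_prod_right'
    (f := fun q : (ℝ × ℝ) × Bdry n => ENNReal.ofReal (q.1.2 ^ d * (2 / q.1.2 ^ (2 * n - 2))) *
        F (endpointVector (q.2, q.2 + q.1.2 • (e : Bdry n), q.1.1))) (by fun_prop)))]
  refine setLIntegral_congr_fun measurableSet_Ioi fun ρ (hρ : 0 < ρ) => ?_
  have hn : ∀ x : Bdry n, ‖x - (x + ρ • (e : Bdry n))‖ = ρ := fun x => by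
    rw [sub_add_cancel_left, norm_neg, norm_smul, he, norm_of_nonneg hρ.le, mul_one]
  simp only [hn]
  rw [lintegral_lintegral_swap (by fun_prop), ← lintegral_const_mul _ (Measurable.lintegral_prod_right'
    (f := fun q : ℝ × Bdry n => ENNReal.ofReal (2 / ρ ^ (2 * n - 2)) *
        F (endpointVector (q.2, q.2 + ρ • (e : Bdry n), q.1))) (by fun_prop))]
  refine lintegral_congr fun t => ?_
  rw [← lintegral_const_mul _ (by fun_prop)]
  refine lintegral_congr fun x => ?_
  rw [ENNReal.ofReal_mul (by positivity), mul_assoc]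

/-- The Liouville measure in endpoint coordinates. -/
theorem unitTangentVolume_eq (d : ℕ) :
    unitTangentVolume (d + 2) = ENNReal.ofReal (2 ^ d) • endpointVolume (d + 2) := by
  ext S hS
  have hd : Module.finrank ℝ (Bdry (d + 2)) = d + 1 := by simp
  set F : Amb (d + 2) × Amb (d + 2) → ℝ≥0∞ := S.indicator 1 with hF
  have hFm : Measurable F := measurable_one.indicator hS
  rw [Measure.smul_apply, smul_eq_mul, ← lintegral_indicator_one hS, ← lintegral_indicator_one hS,
    ← hF, lintegral_unitTangentVolume_eq_aux hd hFm, lintegral_endpointVolume_eq_aux hd hFm,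
    ← lintegral_const_mul' _ _ ENNReal.ofReal_ne_top]
  refine lintegral_congr fun e => ?_
  have he : ‖(e : Bdry (d + 2))‖ = 1 := by simp
  rw [← lintegral_const_mul' _ _ ENNReal.ofReal_ne_top]
  refine lintegral_congr fun t => ?_
  have hc := cosh_pos t
  -- The height is substituted as `z = ρ / (2 cosh t)`, and below `x` is translated from the base
  -- point's horizontal part to the starting endpoint. The Jacobian, `z^(-(d+2))` and the sphere
  -- density combine to `2^(d+1) / ρ^(d+2)`, free of `t`.
  have hc' : 0 < (2 * cosh t)⁻¹ := by positivity
  rw [← lintegral_const_mul' _ _ ENNReal.ofReal_ne_top,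
    lintegral_Ioi_zero_comp_mul_left hc']
  refine setLIntegral_congr_fun measurableSet_Ioi fun ρ (hρ : 0 < ρ) => ?_
  rw [← lintegral_const_mul' _ _ ENNReal.ofReal_ne_top,
    ← lintegral_const_mul' _ _ ENNReal.ofReal_ne_top,
    ← lintegral_add_right_eq_self _ ((ρ / 2 * (1 + tanh t)) • (e : Bdry (d + 2)))]
  refine lintegral_congr fun x => ?_
  have hv : endpointVector (x, x + ρ • (e : Bdry (d + 2)), t)
      = (WithLp.toLp 2 (x + (ρ / 2 * (1 + tanh t)) • (e : Bdry (d + 2)), (2 * cosh t)⁻¹ * ρ),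
        ((2 * cosh t)⁻¹ * ρ) • WithLp.toLp 2 ((cosh t)⁻¹ • (e : Bdry (d + 2)), -tanh t)) := by
    simp only [endpointVector, add_sub_cancel_left, norm_smul, he, norm_of_nonneg hρ.le, mul_one]
    refine Prod.ext (congrArg (WithLp.toLp 2) (Prod.ext ?_ ?_))
      (congrArg (WithLp.toLp 2) (Prod.ext ?_ ?_))
    · module
    · field_simp
    · change _ = ((2 * cosh t)⁻¹ * ρ) • (cosh t)⁻¹ • (e : Bdry (d + 2))
      rw [smul_smul, smul_smul]
      field_simp
    · change _ = ((2 * cosh t)⁻¹ * ρ) * -tanh t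
      rw [tanh_eq_sinh_div_cosh]
      field_simp
  rw [hv, ← mul_assoc, ← mul_assoc, ← ENNReal.ofReal_mul (by positivity),
    ← ENNReal.ofReal_mul (by positivity)]
  congr 2
  rw [show 2 * (d + 2) - 2 = (d + 2) + d by omega]
  simp only [mul_pow, inv_pow, pow_succ, pow_add]
  field_simp

/-! ### Geodesics that cross both planes -/

/-- In the variable `X = e^(2s)` the quotient `(P + Q X) / (α + β X)` is a Möbius function. It
starts at `P / α` and ends at `Q / β`, so, being between `r₁` and `r₂` at `s = 0`, it attains `r₁`
before and `r₂` after exactly when these limits lie strictly outside `[r₁, r₂]`. The products `r₁ *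
α`, `r₂ * β` avoid division: `α` or `β` vanishes for vertical geodesics. -/
theorem exists_exp_combination_iff {P Q α β r₁ r₂ : ℝ} (hα : 0 ≤ α) (hβ : 0 ≤ β)
    (hαβ : 0 < α + β) (hr : r₁ < r₂) (h₁ : r₁ * (α + β) ≤ P + Q) (h₂ : P + Q ≤ r₂ * (α + β)) :
    (∃ s t : ℝ, s ≤ 0 ∧ 0 ≤ t ∧
      P * exp (-s) + Q * exp s = r₁ * (α * exp (-s) + β * exp s) ∧
      P * exp (-t) + Q * exp t = r₂ * (α * exp (-t) + β * exp t)) ↔ P < r₁ * α ∧ r₂ * β < Q := by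
  have key : ∀ (r s : ℝ), P * exp (-s) + Q * exp s = r * (α * exp (-s) + β * exp s) ↔
      P + Q * exp (2 * s) = r * (α + β * exp (2 * s)) := by
    intro r s
    rw [exp_neg, two_mul, exp_add]
    have := exp_pos s
    field_simp
  have hexp : ∀ X : ℝ, 0 < X → exp (2 * (log X / 2)) = X := fun X hX => by
    rw [mul_div_cancel₀ _ two_ne_zero, exp_log hX]
  simp only [key]
  constructor
  · rintro ⟨s, t, hs, ht, e1, e2⟩
    have hX : 0 < exp (2 * s) := exp_pos _
    have hXY : exp (2 * s) ≤ exp (2 * t) := exp_le_exp.2 (by linarith)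
    set X := exp (2 * s)
    set Y := exp (2 * t)
    have p1 : 0 < α + β * X := by
      rcases hα.eq_or_lt with h | h
      · have : 0 < β := by linarith
        positivity
      · positivity
    have hY : 0 < Y := hX.trans_le hXY
    have p2 : 0 < α + β * Y := p1.trans_le (by gcongr)
    -- Eliminating `P`, respectively `Q`, from the two equations leaves positive right-hand sides,
    -- and `Y - X ≥ 0` transfers the sign.
    have f1 : (Q - r₂ * β) * (Y - X) = (r₂ - r₁) * (α + β * X) := by linear_combination e2 - e1
    have f2 : (r₁ * α - P) * (Y - X) = (r₂ - r₁) * X * (α + β * Y) := by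
      linear_combination X * e2 - Y * e1
    have g1 : 0 < (Q - r₂ * β) * (Y - X) := f1 ▸ mul_pos (by linarith) p1
    have g2 : 0 < (r₁ * α - P) * (Y - X) := f2 ▸ mul_pos (mul_pos (by linarith) hX) p2
    have hd : 0 ≤ Y - X := by linarith
    exact ⟨by linarith [pos_of_mul_pos_left g2 hd], by linarith [pos_of_mul_pos_left g1 hd]⟩
  · rintro ⟨hP, hQ⟩
    have q1 : 0 < Q - r₁ * β := by nlinarith
    have q2 : 0 < Q - r₂ * β := by linarith
    have p1 : 0 < r₁ * α - P := by linarith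
    have p2 : 0 < r₂ * α - P := by nlinarith
    have hX := div_pos p1 q1
    have hY := div_pos p2 q2
    -- Solutions of `P + Q X = r (α + β X)` for `r = r₁, r₂`, with `X = e^(2s)`. The signs of the
    -- two logarithms are `h₁` and `h₂`.
    refine ⟨log ((r₁ * α - P) / (Q - r₁ * β)) / 2, log ((r₂ * α - P) / (Q - r₂ * β)) / 2,
      ?_, ?_, ?_, ?_⟩
    · have : log ((r₁ * α - P) / (Q - r₁ * β)) ≤ 0 :=
        log_nonpos hX.le ((div_le_one q1).2 (by linarith))
      linarith
    · have : 0 ≤ log ((r₂ * α - P) / (Q - r₂ * β)) :=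
        log_nonneg ((one_le_div q2).2 (by linarith))
      linarith
    · rw [hexp _ hX]
      field_simp
      ring
    · rw [hexp _ hY]
      field_simp
      ring

/-- The time-reversed form of `exists_exp_combination_iff`. -/
theorem exists_exp_combination_iff' {P Q α β r₁ r₂ : ℝ} (hα : 0 ≤ α) (hβ : 0 ≤ β)
    (hαβ : 0 < α + β) (hr : r₁ < r₂) (h₁ : r₁ * (α + β) ≤ P + Q) (h₂ : P + Q ≤ r₂ * (α + β)) :
    (∃ s t : ℝ, s ≤ 0 ∧ 0 ≤ t ∧
      P * exp (-s) + Q * exp s = r₂ * (α * exp (-s) + β * exp s) ∧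
      P * exp (-t) + Q * exp t = r₁ * (α * exp (-t) + β * exp t)) ↔ r₂ * α < P ∧ Q < r₁ * β := by
  rw [and_comm, ← exists_exp_combination_iff hβ hα (by linarith) hr (by linarith) (by linarith)]
  constructor
  · rintro ⟨s, t, hs, ht, e1, e2⟩
    refine ⟨-t, -s, by linarith, by linarith, ?_, ?_⟩ <;> rw [neg_neg] <;> linarith
  · rintro ⟨s, t, hs, ht, e1, e2⟩
    refine ⟨-t, -s, by linarith, by linarith, ?_, ?_⟩ <;> rw [neg_neg] <;> linarith

/-- Membership in `crossing` when `‖geod p v ·‖ ^ 2` is a quotient of combinations of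
exponentials. -/
theorem mem_crossing_iff_of_geod {n : ℕ} {a : ℝ} (ha : 1 < a) {p v : Amb n} (hp : 0 < p.snd)
    (hv : ‖v‖ = p.snd) {P Q α β : ℝ} (hα : 0 ≤ α) (hβ : 0 ≤ β) (hαβ : 0 < α + β)
    (hg : ∀ s, ‖geod p v s‖ ^ 2 * (α * exp (-s) + β * exp s) = P * exp (-s) + Q * exp s) :
    (p, v) ∈ crossing n a ↔ (1 * (α + β) ≤ P + Q ∧ P + Q ≤ a ^ 2 * (α + β)) ∧
      ((P < 1 * α ∧ a ^ 2 * β < Q) ∨ (a ^ 2 * α < P ∧ Q < 1 * β)) := by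
  have ha0 : 0 < a := by linarith
  have hden : ∀ s, 0 < α * exp (-s) + β * exp s := fun s => by
    rcases hα.eq_or_lt with h | h
    · have : 0 < β := by linarith
      positivity
    · positivity
  have h0 : ‖p‖ ^ 2 * (α + β) = P + Q := by simpa [geod_zero] using hg 0
  have b1 : 1 ≤ ‖p‖ ↔ 1 * (α + β) ≤ P + Q := by
    rw [← h0, mul_le_mul_iff_of_pos_right hαβ, one_le_sq_iff₀ (norm_nonneg p)]
  have b2 : ‖p‖ ≤ a ↔ P + Q ≤ a ^ 2 * (α + β) := by
    rw [← h0, mul_le_mul_iff_of_pos_right hαβ, sq_le_sq₀ (norm_nonneg p) ha0.le]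
  have hr : ∀ r : ℝ, 0 < r → ∀ s, ‖geod p v s‖ = r ↔
      P * exp (-s) + Q * exp s = r ^ 2 * (α * exp (-s) + β * exp s) := fun r hr s => by
    rw [← hg s, mul_left_inj' (hden s).ne', sq_eq_sq₀ (norm_nonneg _) hr.le]
  have h1 := hr 1 one_pos
  rw [one_pow] at h1
  simp only [crossing, mem_ofPred_eq, hp, hv, true_and, h1, hr a ha0, b1, b2]
  rw [← and_assoc]
  refine and_congr_right fun ⟨c1, c2⟩ => ?_
  have hr' : (1 : ℝ) < a ^ 2 := by nlinarith
  rw [← exists_exp_combination_iff hα hβ hαβ hr' c1 c2,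
    ← exists_exp_combination_iff' hα hβ hαβ hr' c1 c2, ← exists_or]
  refine exists_congr fun s => ?_
  rw [← exists_or]
  refine exists_congr fun t => ?_
  tauto

/-- The denominator in `geod` is half of `(1 + c) e^(-s) + (1 - c) e^s` with `c = v.snd / p.snd`.
The coefficients on the right are those matching the value `‖p‖²` and derivative `2⟪p, v⟫` of `‖γ‖²`
at `0`. This form covers vertical geodesics too. -/
theorem norm_sq_geod {n : ℕ} {p v : Amb n} (hp : 0 < p.snd) (hv : ‖v‖ = p.snd) (s : ℝ) :
    ‖geod p v s‖ ^ 2 * ((1 + v.snd / p.snd) * exp (-s) + (1 - v.snd / p.snd) * exp s)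
      = (‖p‖ ^ 2 - (2 * inner ℝ p v - v.snd / p.snd * ‖p‖ ^ 2)) * exp (-s)
        + (‖p‖ ^ 2 + (2 * inner ℝ p v - v.snd / p.snd * ‖p‖ ^ 2)) * exp s := by
  have hD := geod_denom_pos hp hv s
  have h1 := norm_sq_amb v
  rw [hv] at h1
  have hi : inner ℝ p v = inner ℝ p.fst v.fst + v.snd / p.snd * p.snd ^ 2 := by
    rw [WithLp.prod_inner_apply]
    simp
    field_simp
  have hw : ‖v.fst‖ ^ 2 = p.snd ^ 2 * (1 - (v.snd / p.snd) ^ 2) := by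
    field_simp
    linarith
  rw [norm_sq_amb (geod p v s), norm_sq_amb p, hi]
  simp only [geod, WithLp.toLp_fst, WithLp.toLp_snd]
  rw [norm_add_sq_real, norm_smul, mul_pow, Real.norm_eq_abs, sq_abs, hw, real_inner_smul_right]
  have e1 : exp s = cosh s + sinh s := (cosh_add_sinh s).symm
  have e2 : exp (-s) = cosh s - sinh s := (cosh_sub_sinh s).symm
  rw [e1, e2]
  have hc := cosh_sq s
  generalize v.snd / p.snd = c at *
  generalize cosh s = C at *
  generalize sinh s = S at *
  generalize inner ℝ p.fst v.fst = I at *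
  have hD' := hD.ne'
  field_simp
  grind

/-- The existential quantifiers over `s` and `t` are traded for the explicit inequalities of
`mem_crossing_iff_of_geod`, which are visibly measurable in `(p, v)`. -/
theorem measurableSet_crossing (n : ℕ) {a : ℝ} (ha : 1 < a) : MeasurableSet (crossing n a) := by
  have h : crossing n a = {q : Amb n × Amb n | 0 < q.1.snd ∧ ‖q.2‖ = q.1.snd} ∩
      {q | (1 * ((1 + q.2.snd / q.1.snd) + (1 - q.2.snd / q.1.snd)) ≤
        (‖q.1‖ ^ 2 - (2 * inner ℝ q.1 q.2 - q.2.snd / q.1.snd * ‖q.1‖ ^ 2)) +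
        (‖q.1‖ ^ 2 + (2 * inner ℝ q.1 q.2 - q.2.snd / q.1.snd * ‖q.1‖ ^ 2)) ∧
        (‖q.1‖ ^ 2 - (2 * inner ℝ q.1 q.2 - q.2.snd / q.1.snd * ‖q.1‖ ^ 2)) +
        (‖q.1‖ ^ 2 + (2 * inner ℝ q.1 q.2 - q.2.snd / q.1.snd * ‖q.1‖ ^ 2))
          ≤ a ^ 2 * ((1 + q.2.snd / q.1.snd) + (1 - q.2.snd / q.1.snd))) ∧
        (((‖q.1‖ ^ 2 - (2 * inner ℝ q.1 q.2 - q.2.snd / q.1.snd * ‖q.1‖ ^ 2))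
          < 1 * (1 + q.2.snd / q.1.snd) ∧ a ^ 2 * (1 - q.2.snd / q.1.snd) <
          (‖q.1‖ ^ 2 + (2 * inner ℝ q.1 q.2 - q.2.snd / q.1.snd * ‖q.1‖ ^ 2))) ∨
        (a ^ 2 * (1 + q.2.snd / q.1.snd) <
          (‖q.1‖ ^ 2 - (2 * inner ℝ q.1 q.2 - q.2.snd / q.1.snd * ‖q.1‖ ^ 2)) ∧
          (‖q.1‖ ^ 2 + (2 * inner ℝ q.1 q.2 - q.2.snd / q.1.snd * ‖q.1‖ ^ 2))
          < 1 * (1 - q.2.snd / q.1.snd)))} := by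
    ext ⟨p, v⟩
    by_cases hq : 0 < p.snd ∧ ‖v‖ = p.snd
    · obtain ⟨hp, hv⟩ := hq
      have hc : |v.snd / p.snd| ≤ 1 := by
        rw [abs_div, abs_of_pos hp, div_le_one hp, ← hv]
        refine abs_le_of_sq_le_sq ?_ (norm_nonneg v)
        nlinarith [sq_nonneg ‖v.fst‖, norm_sq_amb v]
      rw [abs_le] at hc
      rw [mem_crossing_iff_of_geod ha hp hv (by linarith [hc.1]) (by linarith [hc.2])
        (by linarith) (norm_sq_geod hp hv), mem_inter_iff, mem_ofPred_eq, mem_ofPred_eq]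
      exact ⟨fun h => ⟨⟨hp, hv⟩, h⟩, fun h => h.2⟩
    · exact ⟨fun h => absurd ⟨h.1, h.2.1⟩ hq, fun h => absurd h.1 hq⟩
  rw [h]
  measurability

theorem norm_sq_endpointVector {n : ℕ} (x y : EuclideanSpace ℝ (Fin (n - 1))) (t : ℝ) :
    ‖(endpointVector (x, y, t)).1‖ ^ 2 * (exp (-t) + exp t)
      = ‖x‖ ^ 2 * exp (-t) + ‖y‖ ^ 2 * exp t := by
  rw [norm_sq_amb]
  simp only [endpointVector, WithLp.toLp_fst, WithLp.toLp_snd]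
  have h : (1 / 2 : ℝ) • (x + y) + (tanh t / 2) • (y - x)
      = ((1 - tanh t) / 2) • x + ((1 + tanh t) / 2) • y := by module
  rw [h, norm_add_sq_real, div_pow, norm_sub_sq_real y x, norm_smul, norm_smul,
    real_inner_smul_left, real_inner_smul_right, mul_pow, mul_pow, Real.norm_eq_abs,
    Real.norm_eq_abs, sq_abs, sq_abs, real_inner_comm x y, tanh_eq_sinh_div_cosh,
    (cosh_add_sinh t).symm, (cosh_sub_sinh t).symm]
  have hc := cosh_sq t
  have hp := (cosh_pos t).ne'
  generalize cosh t = C at *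
  generalize sinh t = S at *
  field_simp
  grind

theorem endpointVector_mem_crossing_iff {n : ℕ} {a : ℝ} (ha : 1 < a)
    (x y : EuclideanSpace ℝ (Fin (n - 1))) (t : ℝ) :
    endpointVector (x, y, t) ∈ crossing n a ↔
      ((exp (-t) + exp t ≤ ‖x‖ ^ 2 * exp (-t) + ‖y‖ ^ 2 * exp t ∧
        ‖x‖ ^ 2 * exp (-t) + ‖y‖ ^ 2 * exp t ≤ a ^ 2 * (exp (-t) + exp t)) ∧
      ((‖x‖ ^ 2 < 1 ∧ a ^ 2 < ‖y‖ ^ 2) ∨ (a ^ 2 < ‖x‖ ^ 2 ∧ ‖y‖ ^ 2 < 1))) := by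
  -- On the diagonal `endpointVector` has height `0`, so it is not in `crossing`; the right-hand
  -- side is then contradictory as well.
  by_cases hxy : x = y
  · subst hxy
    constructor
    · intro h
      have : 0 < (endpointVector (x, x, t)).1.snd := h.1
      simp [endpointVector] at this
    · rintro ⟨-, h | h⟩ <;> nlinarith
  have hn : 0 < ‖y - x‖ := norm_pos_iff.mpr (sub_ne_zero.mpr (Ne.symm hxy))
  have hp : 0 < (endpointVector (x, y, t)).1.snd := by
    have := cosh_pos t
    simp only [endpointVector, WithLp.toLp_snd]
    positivity
  rw [← Prod.mk.eta (p := endpointVector (x, y, t)), mem_crossing_iff_of_geod ha hp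
    (norm_endpointVector x y t) (α := exp (-t)) (β := exp t) (P := ‖x‖ ^ 2 * exp (-t))
    (Q := ‖y‖ ^ 2 * exp t) (exp_pos _).le (exp_pos _).le (by positivity)]
  · rw [one_mul, one_mul, one_mul, mul_lt_mul_iff_of_pos_right (exp_pos t),
      mul_lt_mul_iff_of_pos_right (exp_pos (-t)), mul_lt_iff_lt_one_left (exp_pos t),
      mul_lt_iff_lt_one_left (exp_pos (-t))]
  · intro s
    have := norm_sq_endpointVector x y (t + s)
    rw [geod_endpointVector hxy, ← exp_add, ← exp_add, mul_assoc, mul_assoc, ← exp_add, ← exp_add]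
    rwa [neg_add] at this

/-! ### Pairs of points sorted by the line through them -/

section Lines

variable {E F : Type*} [NormedAddCommGroup E] [InnerProductSpace ℝ E] [FiniteDimensional ℝ E]
  [MeasurableSpace E] [BorelSpace E] [NormedAddCommGroup F] [InnerProductSpace ℝ F]
  [FiniteDimensional ℝ F] [MeasurableSpace F] [BorelSpace F]

/-- Any isometry of the two spaces, followed by the reflection in the hyperplane bisecting the image
of `e` and the vertical unit vector. -/
theorem exists_linearIsometryEquiv_prod_real {E F : Type*} [NormedAddCommGroup E]
    [InnerProductSpace ℝ E] [FiniteDimensional ℝ E] [NormedAddCommGroup F] [InnerProductSpace ℝ F]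
    [FiniteDimensional ℝ F] (h : Module.finrank ℝ E = Module.finrank ℝ F + 1) {e : E}
    (he : ‖e‖ = 1) :
    ∃ Φ : E ≃ₗᵢ[ℝ] WithLp 2 (F × ℝ), Φ e = WithLp.toLp 2 (0, 1) := by
  let Ψ : E ≃ₗᵢ[ℝ] WithLp 2 (F × ℝ) := (stdOrthonormalBasis ℝ E).equiv (stdOrthonormalBasis ℝ _)
    (finCongr (h.trans finrank_withLp_prod_real.symm))
  have hn : ‖Ψ e‖ = ‖(WithLp.toLp 2 (0, 1) : WithLp 2 (F × ℝ))‖ := by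
    rw [Ψ.norm_map, he, WithLp.prod_norm_eq_of_L2]
    simp
  exact ⟨Ψ.trans (ℝ ∙ (Ψ e - WithLp.toLp 2 (0, 1)))ᗮ.reflection, Submodule.reflection_sub hn⟩

theorem lintegral_add_smul_of_norm_eq_one (h : Module.finrank ℝ E = Module.finrank ℝ F + 1)
    {e : E} (he : ‖e‖ = 1) {g : ℝ × ℝ → ℝ≥0∞} (hg : Measurable g) (ρ : ℝ) :
    ∫⁻ x : E, g (‖x‖ ^ 2, ‖x + ρ • e‖ ^ 2)
      = ∫⁻ y : F, ∫⁻ s : ℝ, g (‖y‖ ^ 2 + s ^ 2, ‖y‖ ^ 2 + (s + ρ) ^ 2) := by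
  obtain ⟨Φ, hΦ⟩ := exists_linearIsometryEquiv_prod_real h he
  have h1 : ∀ x : E, g (‖x‖ ^ 2, ‖x + ρ • e‖ ^ 2) = (fun w : WithLp 2 (F × ℝ) =>
      g (‖w‖ ^ 2, ‖w + ρ • WithLp.toLp 2 (0, 1)‖ ^ 2)) (Φ x) := fun x => by
    dsimp only
    rw [← hΦ, ← map_smul, ← map_add, Φ.norm_map, Φ.norm_map]
  have h2 : ∀ (y : F) (s : ℝ), ‖(WithLp.toLp 2 (y, s) : WithLp 2 (F × ℝ))‖ ^ 2 = ‖y‖ ^ 2 + s ^ 2 :=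
    fun y s => by simp [WithLp.prod_norm_sq_eq_of_L2]
  refine (lintegral_congr h1).trans ?_
  rw [Φ.measurePreserving.lintegral_comp (f := fun w : WithLp 2 (F × ℝ) =>
    g (‖w‖ ^ 2, ‖w + ρ • WithLp.toLp 2 (0, 1)‖ ^ 2)) (by fun_prop),
    lintegral_withLp_prod (by fun_prop)]
  refine lintegral_congr fun y => lintegral_congr fun s => ?_
  have h3 : (WithLp.toLp 2 (y, s) : WithLp 2 (F × ℝ)) + ρ • WithLp.toLp 2 (0, 1)
      = WithLp.toLp 2 (y, s + ρ) := by
    rw [← WithLp.toLp_smul, ← WithLp.toLp_add]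
    simp
  rw [h3, h2, h2]

/-- Integration of a function of two points that depends only on their norms and their distance:
the line through the two points is at distance `r` from the origin. -/
theorem lintegral_pair_eq_lintegral_line {m : ℕ} (hE : Module.finrank ℝ E = m + 2)
    (hF : Module.finrank ℝ F = m + 1) {G : ℝ × ℝ × ℝ → ℝ≥0∞} (hG : Measurable G) :
    ∫⁻ x : E, ∫⁻ y : E, G (‖x‖ ^ 2, ‖y‖ ^ 2, ‖x - y‖)
      = (volume : Measure E).toSphere univ * (volume : Measure F).toSphere univ *
        ∫⁻ r in Ioi (0 : ℝ), ENNReal.ofReal (r ^ m) * ∫⁻ s : ℝ, ∫⁻ ρ in Ioi (0 : ℝ),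
          ENNReal.ofReal (ρ ^ (m + 1)) * G (r ^ 2 + s ^ 2, r ^ 2 + (s + ρ) ^ 2, ρ) := by
  have hm : Measurable fun q : E × E => G (‖q.1‖ ^ 2, ‖q.2‖ ^ 2, ‖q.1 - q.2‖) := by fun_prop
  refine (lintegral_pair_polar hE hm).trans ?_
  have hpolar : ∀ ρ : ℝ, ∫⁻ y : F, ∫⁻ s : ℝ, G (‖y‖ ^ 2 + s ^ 2, ‖y‖ ^ 2 + (s + ρ) ^ 2, ρ)
      = (volume : Measure F).toSphere univ * ∫⁻ r in Ioi (0 : ℝ), ENNReal.ofReal (r ^ m) *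
          ∫⁻ s : ℝ, G (r ^ 2 + s ^ 2, r ^ 2 + (s + ρ) ^ 2, ρ) := fun ρ => by
    rw [lintegral_polar hF (Measurable.lintegral_prod_right' (f := fun q : F × ℝ =>
      G (‖q.1‖ ^ 2 + q.2 ^ 2, ‖q.1‖ ^ 2 + (q.2 + ρ) ^ 2, ρ)) (by fun_prop)), mul_comm,
      ← lintegral_const]
    refine lintegral_congr fun e => setLIntegral_congr_fun measurableSet_Ioi
      fun r (hr : 0 < r) => ?_
    have he : ‖(e : F)‖ = 1 := by simp
    simp only [norm_smul, he, norm_of_nonneg hr.le, mul_one]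
  have hinner : ∀ e : Metric.sphere (0 : E) 1, (∫⁻ ρ in Ioi (0 : ℝ), ENNReal.ofReal (ρ ^ (m + 1)) *
      ∫⁻ x : E, G (‖x‖ ^ 2, ‖x + ρ • (e : E)‖ ^ 2, ‖x - (x + ρ • (e : E))‖))
      = (volume : Measure F).toSphere univ * ∫⁻ ρ in Ioi (0 : ℝ), ENNReal.ofReal (ρ ^ (m + 1)) *
        ∫⁻ r in Ioi (0 : ℝ), ENNReal.ofReal (r ^ m) *
          ∫⁻ s : ℝ, G (r ^ 2 + s ^ 2, r ^ 2 + (s + ρ) ^ 2, ρ) := fun e => by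
    have he : ‖(e : E)‖ = 1 := by simp
    rw [← lintegral_const_mul' _ _ (measure_ne_top _ _)]
    refine setLIntegral_congr_fun measurableSet_Ioi fun ρ (hρ : 0 < ρ) => ?_
    have hn : ∀ x : E, ‖x - (x + ρ • (e : E))‖ = ρ := fun x => by
      rw [sub_add_cancel_left, norm_neg, norm_smul, he, norm_of_nonneg hρ.le, mul_one]
    simp only [hn]
    rw [lintegral_add_smul_of_norm_eq_one (F := F) (by omega) he (g := fun q => G (q.1, q.2, ρ))
      (by fun_prop), hpolar, mul_left_comm]
  -- The inner integral no longer depends on the direction `e`, so the outer one only contributes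
  -- the sphere volume of `E`. The rest reorders the integrations over `ρ`, `r`, `s`.
  refine (lintegral_congr hinner).trans ?_
  rw [lintegral_const, mul_comm, mul_assoc]
  congr 2
  have hm1 : Measurable fun q : (ℝ × ℝ) × ℝ =>
      G (q.1.2 ^ 2 + q.2 ^ 2, q.1.2 ^ 2 + (q.2 + q.1.1) ^ 2, q.1.1) := by fun_prop
  have hm2 := hm1.lintegral_prod_right' (ν := (volume : Measure ℝ))
  have hm3 : Measurable fun q : ℝ × ℝ => ENNReal.ofReal (q.1 ^ (m + 1)) *
      (ENNReal.ofReal (q.2 ^ m) *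
        ∫⁻ s : ℝ, G (q.2 ^ 2 + s ^ 2, q.2 ^ 2 + (s + q.1) ^ 2, q.1)) := by
    dsimp only at hm2
    fun_prop
  calc
    _ = ∫⁻ ρ in Ioi (0 : ℝ), ∫⁻ r in Ioi (0 : ℝ), ENNReal.ofReal (ρ ^ (m + 1)) *
          (ENNReal.ofReal (r ^ m) * ∫⁻ s : ℝ, G (r ^ 2 + s ^ 2, r ^ 2 + (s + ρ) ^ 2, ρ)) :=
      lintegral_congr fun ρ => (lintegral_const_mul' _ _ ENNReal.ofReal_ne_top).symm
    _ = _ := by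
      rw [lintegral_lintegral_swap hm3.aemeasurable]
      refine lintegral_congr fun r => ?_
      have hm4 : Measurable fun q : ℝ × ℝ => ENNReal.ofReal (q.1 ^ (m + 1)) *
        G (r ^ 2 + q.2 ^ 2, r ^ 2 + (q.2 + q.1) ^ 2, q.1) := by fun_prop
      rw [← lintegral_lintegral_swap hm4.aemeasurable,
        ← lintegral_const_mul' _ _ ENNReal.ofReal_ne_top]
      refine lintegral_congr fun ρ => ?_
      rw [mul_left_comm, lintegral_const_mul' _ _ ENNReal.ofReal_ne_top]

end Lines

/-! ### Arc lengths and the reduction to `M` -/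

/-- The length of the arc between the hyperbolic planes `‖p‖ = 1` and `‖p‖ = a` of a geodesic whose
endpoints have norms with squares `X < 1` and `Y > a ^ 2`; zero for other values of `X` and `Y`. -/
def arcLength (a X Y : ℝ) : ℝ≥0∞ :=
  if X < 1 ∧ a ^ 2 < Y then
    ENNReal.ofReal (1 / 2 * log ((a ^ 2 - X) * (Y - 1) / ((Y - a ^ 2) * (1 - X)))) else 0

theorem measurable_arcLength (a : ℝ) : Measurable fun q : ℝ × ℝ => arcLength a q.1 q.2 := by
  unfold arcLength
  refine Measurable.ite ?_ (by fun_prop) measurable_const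
  exact (measurableSet_lt measurable_fst measurable_const).inter
    (measurableSet_lt measurable_const measurable_snd)

theorem volume_arc {a X Y : ℝ} (ha : 1 < a) (hX : X < 1) (hY : a ^ 2 < Y) :
    volume {t : ℝ | exp (-t) + exp t ≤ X * exp (-t) + Y * exp t ∧
      X * exp (-t) + Y * exp t ≤ a ^ 2 * (exp (-t) + exp t)} = arcLength a X Y := by
  have ha2 : 1 < a ^ 2 := by nlinarith
  have h1 : 0 < (1 - X) / (Y - 1) := div_pos (by linarith) (by linarith)
  have h2 : 0 < (a ^ 2 - X) / (Y - a ^ 2) := div_pos (by linarith) (by linarith)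
  have : {t : ℝ | exp (-t) + exp t ≤ X * exp (-t) + Y * exp t ∧
      X * exp (-t) + Y * exp t ≤ a ^ 2 * (exp (-t) + exp t)} =
      Icc (log ((1 - X) / (Y - 1)) / 2) (log ((a ^ 2 - X) / (Y - a ^ 2)) / 2) := by
    ext t
    have he : exp t = exp (2 * t) * exp (-t) := by rw [← exp_add]; ring_nf
    have hp := exp_pos (-t)
    simp only [mem_ofPred_eq, mem_Icc]
    refine and_congr ?_ ?_
    · rw [div_le_iff₀ two_pos, mul_comm t, log_le_iff_le_exp h1, div_le_iff₀ (by linarith), he]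
      constructor <;> intro h
      · refine le_of_mul_le_mul_right ?_ hp
        linarith
      · linarith [mul_le_mul_of_nonneg_right h hp.le]
    · rw [le_div_iff₀ two_pos, mul_comm t, le_log_iff_exp_le h2, le_div_iff₀ (by linarith), he]
      constructor <;> intro h
      · refine le_of_mul_le_mul_right ?_ hp
        linarith
      · linarith [mul_le_mul_of_nonneg_right h hp.le]
  rw [this, Real.volume_Icc, arcLength, if_pos ⟨hX, hY⟩, ← sub_div, ← log_div h2.ne' h1.ne',
    div_div_div_eq]
  congr 1
  ring

theorem volume_endpointVector_preimage_crossing {n : ℕ} {a : ℝ} (ha : 1 < a) (x y : Bdry n) :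
    volume {t : ℝ | endpointVector (x, y, t) ∈ crossing n a}
      = arcLength a (‖x‖ ^ 2) (‖y‖ ^ 2) + arcLength a (‖y‖ ^ 2) (‖x‖ ^ 2) := by
  have ha2 : 1 < a ^ 2 := by nlinarith
  simp only [endpointVector_mem_crossing_iff ha]
  by_cases h1 : ‖x‖ ^ 2 < 1 ∧ a ^ 2 < ‖y‖ ^ 2
  · have h2 : arcLength a (‖y‖ ^ 2) (‖x‖ ^ 2) = 0 := if_neg fun h => by linarith [h.1, h1.2]
    simp only [h1, and_self, true_or, and_true]
    rw [volume_arc ha h1.1 h1.2, h2, add_zero]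
  by_cases h2 : ‖y‖ ^ 2 < 1 ∧ a ^ 2 < ‖x‖ ^ 2
  · have h3 : arcLength a (‖x‖ ^ 2) (‖y‖ ^ 2) = 0 := if_neg h1
    rw [h3, zero_add, ← volume_arc ha h2.1 h2.2, ← Measure.measure_preimage_neg]
    simp only [h2, and_self, or_true, and_true]
    congr 1
    ext t
    simp only [mem_ofPred_eq, mem_preimage, neg_neg]
    rw [add_comm (exp t), add_comm (_ * exp t)]
  · have h3 : ¬ (a ^ 2 < ‖x‖ ^ 2 ∧ ‖y‖ ^ 2 < 1) := fun h => h2 h.symm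
    simp only [h1, h3, or_self, and_false]
    rw [arcLength, arcLength, if_neg h1, if_neg h2]
    simp

/-- The outer factor `2` counts the two orientations, which the swap of `x` and `y` exchanges. -/
theorem endpointVolume_crossing (n : ℕ) {a : ℝ} (ha : 1 < a) :
    endpointVolume n (crossing n a) = 2 * ∫⁻ x : Bdry n, ∫⁻ y : Bdry n,
      ENNReal.ofReal (2 / ‖x - y‖ ^ (2 * n - 2)) * arcLength a (‖x‖ ^ 2) (‖y‖ ^ 2) := by
  have hS := measurableSet_crossing n ha
  have hA := measurable_arcLength a
  have hm : ∀ w : Bdry n × Bdry n → ℝ × ℝ, Measurable w → Measurable fun q : Bdry n × Bdry n =>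
      ENNReal.ofReal (2 / ‖q.1 - q.2‖ ^ (2 * n - 2)) * arcLength a (w q).1 (w q).2 :=
    fun w hw => (by fun_prop : Measurable fun q : Bdry n × Bdry n =>
      ENNReal.ofReal (2 / ‖q.1 - q.2‖ ^ (2 * n - 2))).mul (hA.comp hw)
  have hm1 := hm (fun q => (‖q.1‖ ^ 2, ‖q.2‖ ^ 2)) (by fun_prop)
  have hm2 := hm (fun q => (‖q.2‖ ^ 2, ‖q.1‖ ^ 2)) (by fun_prop)
  have e1 : endpointVolume n (crossing n a) = ∫⁻ x : Bdry n, ∫⁻ y : Bdry n,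
      (ENNReal.ofReal (2 / ‖x - y‖ ^ (2 * n - 2)) * arcLength a (‖x‖ ^ 2) (‖y‖ ^ 2) +
        ENNReal.ofReal (2 / ‖x - y‖ ^ (2 * n - 2)) * arcLength a (‖y‖ ^ 2) (‖x‖ ^ 2)) := by
    rw [← lintegral_indicator_one hS, lintegral_endpointVolume (measurable_one.indicator hS)]
    refine lintegral_congr fun x => lintegral_congr fun y => ?_
    rw [lintegral_const_mul' _ _ ENNReal.ofReal_ne_top, ← mul_add,
      ← volume_endpointVector_preimage_crossing ha]
    have hT : MeasurableSet {t : ℝ | endpointVector (x, y, t) ∈ crossing n a} :=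
      hS.preimage (measurable_endpointVector.comp (by fun_prop : Measurable fun t : ℝ => (x, y, t)))
    rw [← lintegral_indicator_one hT]
    exact congrArg _ (lintegral_congr fun t => rfl)
  have e2 : ∫⁻ x : Bdry n, ∫⁻ y : Bdry n,
        ENNReal.ofReal (2 / ‖x - y‖ ^ (2 * n - 2)) * arcLength a (‖y‖ ^ 2) (‖x‖ ^ 2)
      = ∫⁻ x : Bdry n, ∫⁻ y : Bdry n,
        ENNReal.ofReal (2 / ‖x - y‖ ^ (2 * n - 2)) * arcLength a (‖x‖ ^ 2) (‖y‖ ^ 2) := by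
    rw [lintegral_lintegral_swap hm2.aemeasurable]
    refine lintegral_congr fun x => lintegral_congr fun y => ?_
    rw [norm_sub_rev]
  have hl : ∀ x : Bdry n, Measurable fun y : Bdry n =>
      ENNReal.ofReal (2 / ‖x - y‖ ^ (2 * n - 2)) * arcLength a (‖x‖ ^ 2) (‖y‖ ^ 2) := fun x =>
    Measurable.mul (by fun_prop)
      (hA.comp (by fun_prop : Measurable fun y : Bdry n => (‖x‖ ^ 2, ‖y‖ ^ 2)))
  rw [e1, lintegral_congr fun x => lintegral_add_left (hl x) _]
  refine (lintegral_add_left hm1.lintegral_prod_right' _).trans ?_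
  rw [e2]
  exact (two_mul _).symm

/-- The integral `M n b` as an element of `[0, ∞]`. -/
def lintegralM (n : ℕ) (b : ℝ) : ℝ≥0∞ :=
  ∫⁻ u in Ioo (-1 : ℝ) 1, ∫⁻ v in Ioi b, ENNReal.ofReal (kernelM n b u v)

/-- The parameter of `M` for lines at distance `r` from the origin. -/
def paramB (a r : ℝ) : ℝ := √((a ^ 2 - r ^ 2) / (1 - r ^ 2))

theorem sq_paramB {a r : ℝ} (ha : 1 < a) (hr : r ∈ Ioo (0 : ℝ) 1) :
    paramB a r ^ 2 = (a ^ 2 - r ^ 2) / (1 - r ^ 2) := by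
  obtain ⟨h0, h1⟩ := hr
  exact sq_sqrt (div_nonneg (by nlinarith) (by nlinarith))

theorem lt_paramB {a r : ℝ} (ha : 1 < a) (hr : r ∈ Ioo (0 : ℝ) 1) : a < paramB a r := by
  obtain ⟨h0, h1⟩ := hr
  have h2 : 0 < 1 - r ^ 2 := by nlinarith
  refine lt_sqrt_of_sq_lt ((lt_div_iff₀ h2).2 ?_)
  nlinarith [mul_pos h0 h0, mul_pos (mul_pos h0 h0) (show 0 < a ^ 2 - 1 by nlinarith)]

/-- With `c = √(1 - r²)`, the points of the line at positions `c u` and `c v` have squared norms `r²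
+ c² u²` and `r² + c² v²`. Since `c² b² = a² - r²`, the conditions become `|u| < 1` and `|v| > b`,
and all factors `c²` cancel in the logarithm. The powers of `c` add up to `-(m + 1)`, those of `v -
u` to `-(m + 3)`; the `2` of the density absorbs the `1 / 2` of `arcLength`. -/
theorem lintegral_line_eq {m : ℕ} {a r u : ℝ} (ha : 1 < a) (hr : r ∈ Ioo (0 : ℝ) 1) :
    ENNReal.ofReal √(1 - r ^ 2) * ∫⁻ τ in Ioi (0 : ℝ), ENNReal.ofReal √(1 - r ^ 2) *
      (ENNReal.ofReal ((√(1 - r ^ 2) * τ) ^ (m + 1)) *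
        (ENNReal.ofReal (2 / (√(1 - r ^ 2) * τ) ^ (2 * (m + 3) - 2)) *
          arcLength a (r ^ 2 + (√(1 - r ^ 2) * u) ^ 2)
            (r ^ 2 + (√(1 - r ^ 2) * u + √(1 - r ^ 2) * τ) ^ 2)))
      = (Ioo (-1 : ℝ) 1).indicator (fun u => ENNReal.ofReal (1 / √(1 - r ^ 2) ^ (m + 1)) *
          ∫⁻ v in Ioi (paramB a r), ENNReal.ofReal (kernelM (m + 3) (paramB a r) u v)) u := by
  have hab := lt_paramB ha hr
  have hb2 := sq_paramB ha hr
  obtain ⟨h0, h1⟩ := hr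
  have h2 : 0 < 1 - r ^ 2 := by nlinarith
  have hc2 : √(1 - r ^ 2) ^ 2 = 1 - r ^ 2 := sq_sqrt h2.le
  have hc : 0 < √(1 - r ^ 2) := sqrt_pos.2 h2
  rw [eq_div_iff h2.ne', ← hc2] at hb2
  generalize √(1 - r ^ 2) = c at *
  generalize paramB a r = b at *
  by_cases hu : u ∈ Ioo (-1 : ℝ) 1
  swap
  · rw [indicator_of_notMem hu]
    have hu2 : 1 ≤ u ^ 2 := by
      by_contra! h
      exact hu (abs_lt.1 ((sq_lt_one_iff_abs_lt_one u).1 h))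
    have : ∀ Y, arcLength a (r ^ 2 + (c * u) ^ 2) Y = 0 := fun Y =>
      if_neg fun h => by nlinarith [h.1]
    simp [this]
  have hu2 : u ^ 2 < 1 := by rw [sq_lt_one_iff_abs_lt_one, abs_lt]; exact hu
  have hX : r ^ 2 + (c * u) ^ 2 < 1 := by nlinarith
  rw [indicator_of_mem hu, ← lintegral_const_mul' _ _ ENNReal.ofReal_ne_top,
    ← lintegral_const_mul' _ _ ENNReal.ofReal_ne_top, ← lintegral_indicator measurableSet_Ioi,
    ← lintegral_indicator measurableSet_Ioi]
  -- The substitution `τ = v - u`.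
  rw [← lintegral_sub_right_eq_self _ u]
  refine lintegral_congr fun v => ?_
  have hv : c * u + c * (v - u) = c * v := by ring
  by_cases hvb : b < v
  · have huv : 0 < v - u := by linarith [hu.2]
    have hv2 : b ^ 2 < v ^ 2 := by nlinarith
    have hY : a ^ 2 < r ^ 2 + (c * v) ^ 2 := by nlinarith
    have hlog : (a ^ 2 - (r ^ 2 + (c * u) ^ 2)) * (r ^ 2 + (c * v) ^ 2 - 1) /
        ((r ^ 2 + (c * v) ^ 2 - a ^ 2) * (1 - (r ^ 2 + (c * u) ^ 2)))
        = (v ^ 2 - 1) * (u ^ 2 - b ^ 2) / ((v ^ 2 - b ^ 2) * (u ^ 2 - 1)) := by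
      have k1 : a ^ 2 - (r ^ 2 + (c * u) ^ 2) = c ^ 2 * (b ^ 2 - u ^ 2) := by linear_combination -hb2
      have k2 : r ^ 2 + (c * v) ^ 2 - 1 = c ^ 2 * (v ^ 2 - 1) := by linear_combination hc2
      have k3 : r ^ 2 + (c * v) ^ 2 - a ^ 2 = c ^ 2 * (v ^ 2 - b ^ 2) := by linear_combination hb2
      have k4 : 1 - (r ^ 2 + (c * u) ^ 2) = c ^ 2 * (1 - u ^ 2) := by linear_combination -hc2
      have k5 : v ^ 2 - b ^ 2 ≠ 0 := by linarith
      have k6 : 1 - u ^ 2 ≠ 0 := by linarith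
      have k7 : u ^ 2 - 1 ≠ 0 := by linarith
      rw [k1, k2, k3, k4]
      field_simp
      grind
    rw [indicator_of_mem (show v - u ∈ Ioi 0 from huv), indicator_of_mem (show v ∈ Ioi b from hvb),
      hv, arcLength, if_pos ⟨hX, hY⟩, hlog, kernelM, ← ENNReal.ofReal_mul (by positivity),
      ← ENNReal.ofReal_mul (by positivity), ← ENNReal.ofReal_mul (by positivity),
      ← ENNReal.ofReal_mul (by positivity), ← ENNReal.ofReal_mul (by positivity)]
    congr 1
    rw [show 2 * (m + 3) - 2 = (m + 1) + (m + 3) by omega]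
    simp only [mul_pow, pow_add]
    field_simp
  · rw [indicator_of_notMem (show v ∉ Ioi b from hvb)]
    by_cases huv : 0 < v - u
    · have hv2 : v ^ 2 ≤ b ^ 2 := by nlinarith [hu.1]
      have : arcLength a (r ^ 2 + (c * u) ^ 2) (r ^ 2 + (c * v) ^ 2) = 0 :=
        if_neg fun h => by nlinarith [h.2]
      rw [indicator_of_mem (show v - u ∈ Ioi 0 from huv), hv, this]
      simp
    · rw [indicator_of_notMem (show v - u ∉ Ioi 0 from huv)]

theorem lintegral_lines_eq {m : ℕ} {a r : ℝ} (ha : 1 < a) (hr : r ∈ Ioo (0 : ℝ) 1) :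
    ∫⁻ s : ℝ, ∫⁻ ρ in Ioi (0 : ℝ), ENNReal.ofReal (ρ ^ (m + 1)) *
        (ENNReal.ofReal (2 / ρ ^ (2 * (m + 3) - 2)) *
          arcLength a (r ^ 2 + s ^ 2) (r ^ 2 + (s + ρ) ^ 2))
      = ENNReal.ofReal (1 / √(1 - r ^ 2) ^ (m + 1)) * lintegralM (m + 3) (paramB a r) := by
  have hc : 0 < √(1 - r ^ 2) := sqrt_pos.2 (by nlinarith [hr.1, hr.2])
  rw [lintegral_comp_mul_left hc, lintegralM, ← lintegral_const_mul' _ _ ENNReal.ofReal_ne_top,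
    ← lintegral_indicator measurableSet_Ioo]
  refine lintegral_congr fun u => ?_
  rw [lintegral_Ioi_zero_comp_mul_left hc]
  exact lintegral_line_eq ha hr

theorem endpointVolume_crossing_eq (m : ℕ) {a : ℝ} (ha : 1 < a) :
    endpointVolume (m + 3) (crossing (m + 3) a) =
      2 * ((volume : Measure (EuclideanSpace ℝ (Fin (m + 2)))).toSphere univ *
        (volume : Measure (EuclideanSpace ℝ (Fin (m + 1)))).toSphere univ *
        ∫⁻ r in Ioo (0 : ℝ) 1, ENNReal.ofReal (r ^ m / √(1 - r ^ 2) ^ (m + 1)) *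
          lintegralM (m + 3) (paramB a r)) := by
  have hA := measurable_arcLength a
  have hG : Measurable fun q : ℝ × ℝ × ℝ =>
      ENNReal.ofReal (2 / q.2.2 ^ (2 * (m + 3) - 2)) * arcLength a q.1 q.2.1 :=
    Measurable.mul (by fun_prop) (hA.comp (by fun_prop : Measurable fun q : ℝ × ℝ × ℝ =>
      (q.1, q.2.1)))
  rw [endpointVolume_crossing (m + 3) ha]
  refine congrArg (fun z : ℝ≥0∞ => 2 * z) ((lintegral_pair_eq_lintegral_line (m := m) (E := Bdry (m + 3))
    (F := EuclideanSpace ℝ (Fin (m + 1))) (by simp) (by simp) hG).trans ?_)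
  refine congrArg (HMul.hMul _) ?_
  dsimp only
  rw [← lintegral_indicator measurableSet_Ioi, ← lintegral_indicator measurableSet_Ioo]
  refine lintegral_congr fun r => ?_
  by_cases hr : r ∈ Ioo (0 : ℝ) 1
  · rw [indicator_of_mem hr, indicator_of_mem (show r ∈ Ioi 0 from hr.1), lintegral_lines_eq ha hr,
      ← mul_assoc, ← ENNReal.ofReal_mul (pow_nonneg hr.1.le m), mul_one_div]
  · rw [indicator_of_notMem hr]
    -- A line with `r ≥ 1` misses the open unit ball, so neither of its points can have norm `< 1`.
    by_cases h0 : 0 < r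
    · have h1 : 1 ≤ r := by
        by_contra! h
        exact hr ⟨h0, h⟩
      have : ∀ s Y, arcLength a (r ^ 2 + s ^ 2) Y = 0 := fun s Y =>
        if_neg fun h => by nlinarith [h.1]
      simp [this]
    · rw [indicator_of_notMem (show r ∉ Ioi 0 from h0)]

/-! ### Convergence of the integrals -/

/-- This replaces the logarithmic singularities at `u = ±1` and `v = b` by inverse square roots,
whose primitives are explicit. -/
theorem log_one_add_le_two_mul_sqrt {x : ℝ} (hx : 0 ≤ x) : log (1 + x) ≤ 2 * √x := by
  have h := sqrt_nonneg x
  calc log (1 + x) ≤ log ((1 + √x) ^ 2) :=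
        log_le_log (by linarith) (by nlinarith [sq_sqrt hx])
    _ = 2 * log (1 + √x) := by rw [log_pow]; norm_num
    _ ≤ 2 * √x := by linarith [log_le_sub_one_of_pos (show 0 < 1 + √x by linarith)]

theorem kernelM_eq {n : ℕ} {b u v : ℝ} (hb : 1 < b) (hu : u ∈ Ioo (-1 : ℝ) 1) (hv : b < v) :
    kernelM n b u v = (log (1 + (b ^ 2 - 1) / (v ^ 2 - b ^ 2)) +
      log (1 + (b ^ 2 - 1) / (1 - u ^ 2))) / (v - u) ^ n := by
  have hu2 : 0 < 1 - u ^ 2 := by nlinarith [hu.1, hu.2]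
  have hv2 : 0 < v ^ 2 - b ^ 2 := by nlinarith
  have hb2 : 0 < b ^ 2 - 1 := by nlinarith
  have hu2' : u ^ 2 - 1 ≠ 0 := by linarith
  rw [kernelM, ← log_mul (by positivity) (by positivity)]
  congr 2
  field_simp
  grind

theorem kernelM_nonneg {n : ℕ} {b u v : ℝ} (hb : 1 < b) (hu : u ∈ Ioo (-1 : ℝ) 1) (hv : b < v) :
    0 ≤ kernelM n b u v := by
  have hu2 : 0 < 1 - u ^ 2 := by nlinarith [hu.1, hu.2]
  have hv2 : 0 < v ^ 2 - b ^ 2 := by nlinarith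
  have hb2 : 0 < b ^ 2 - 1 := by nlinarith
  have huv : 0 < v - u := by linarith [hu.2]
  rw [kernelM_eq hb hu hv]
  have h1 := log_nonneg (le_add_of_nonneg_right (a := (1 : ℝ)) (div_pos hb2 hv2).le)
  have h2 := log_nonneg (le_add_of_nonneg_right (a := (1 : ℝ)) (div_pos hb2 hu2).le)
  positivity

theorem measurable_kernelM (n : ℕ) :
    Measurable fun q : ℝ × ℝ × ℝ => kernelM n q.1 q.2.1 q.2.2 := by
  unfold kernelM
  fun_prop

theorem measurable_kernelM_right (n : ℕ) (b : ℝ) :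
    Measurable fun q : ℝ × ℝ => kernelM n b q.1 q.2 := by
  unfold kernelM
  fun_prop

/-- The substitution `v = b w` makes the bound uniform in `b ≥ a`; the factor `b` on the left is its
Jacobian. Each logarithm is `O(b)`, and `v - u ≥ (1 - 1 / a) v` because `u < 1 ≤ v / a`, which
leaves `b * b / b^(m+3)`. -/
theorem kernelM_mul_le {m : ℕ} {a b u w : ℝ} (ha : 1 < a) (hab : a ≤ b) (hu : u ∈ Ioo (-1 : ℝ) 1)
    (hw : 1 < w) :
    b * kernelM (m + 3) b u (b * w) ≤ 2 / (1 - 1 / a) ^ (m + 3) * (1 / b ^ (m + 1)) *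
      (1 / (w ^ 2 * √(1 - 1 / w)) + 1 / √(1 - u ^ 2) * (1 / w ^ 2)) := by
  have hb : 1 < b := ha.trans_le hab
  have hb0 : 0 < b := by linarith
  have hw0 : 0 < w := by linarith
  have hv : b < b * w := by nlinarith
  have hu2 : 0 < 1 - u ^ 2 := by nlinarith [hu.1, hu.2]
  have hb2 : 0 < b ^ 2 - 1 := by nlinarith
  have hv2 : 0 < (b * w) ^ 2 - b ^ 2 := by nlinarith
  have hw1 : 0 < 1 - 1 / w := by
    rw [sub_pos, div_lt_one hw0]
    exact hw
  have hκ : 0 < 1 - 1 / a := by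
    rw [sub_pos, div_lt_one (by linarith)]
    exact ha
  have hd : (1 - 1 / a) * (b * w) ≤ b * w - u := by
    have : 1 ≤ 1 / a * (b * w) := by
      rw [one_div_mul_eq_div, one_le_div (by linarith)]
      linarith
    linarith [hu.2]
  have l1 : log (1 + (b ^ 2 - 1) / ((b * w) ^ 2 - b ^ 2)) ≤ 2 * (b / √(1 - 1 / w)) := by
    refine (log_one_add_le_two_mul_sqrt (div_pos hb2 hv2).le).trans ?_
    rw [mul_le_mul_iff_right₀ two_pos, sqrt_le_iff, div_pow, sq_sqrt hw1.le]
    refine ⟨by positivity, ?_⟩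
    have hw2 : 1 - 1 / w ≤ (b * w) ^ 2 - b ^ 2 := by
      have : 1 - 1 / w ≤ w ^ 2 - 1 := by
        have h3 : w⁻¹ * w = 1 := inv_mul_cancel₀ hw0.ne'
        have h4 : 0 < w⁻¹ := inv_pos.2 hw0
        rw [one_div]
        nlinarith
      nlinarith
    gcongr
    linarith
  have l2 : log (1 + (b ^ 2 - 1) / (1 - u ^ 2)) ≤ 2 * (b / √(1 - u ^ 2)) := by
    refine (log_one_add_le_two_mul_sqrt (div_pos hb2 hu2).le).trans ?_
    rw [mul_le_mul_iff_right₀ two_pos, sqrt_le_iff, div_pow, sq_sqrt hu2.le]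
    refine ⟨by positivity, ?_⟩
    gcongr
    linarith
  have hw3 : w ^ 2 ≤ w ^ (m + 3) := pow_le_pow_right₀ hw.le (by omega)
  rw [kernelM_eq hb hu hv]
  have s1 := sqrt_pos.2 hw1
  have s2 := sqrt_pos.2 hu2
  calc b * ((log (1 + (b ^ 2 - 1) / ((b * w) ^ 2 - b ^ 2)) +
        log (1 + (b ^ 2 - 1) / (1 - u ^ 2))) / (b * w - u) ^ (m + 3))
      ≤ b * ((2 * (b / √(1 - 1 / w)) + 2 * (b / √(1 - u ^ 2))) /
          ((1 - 1 / a) * (b * w)) ^ (m + 3)) := by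
        gcongr
    _ = 2 / (1 - 1 / a) ^ (m + 3) * (1 / b ^ (m + 1)) * (1 / √(1 - 1 / w) + 1 / √(1 - u ^ 2)) *
          (1 / w ^ (m + 3)) := by
        simp only [mul_pow, pow_add b]
        field_simp
    _ ≤ 2 / (1 - 1 / a) ^ (m + 3) * (1 / b ^ (m + 1)) * (1 / √(1 - 1 / w) + 1 / √(1 - u ^ 2)) *
          (1 / w ^ 2) := by
        gcongr
    _ = _ := by
        field_simp

theorem integrableOn_one_div_sqrt_one_sub_sq :
    IntegrableOn (fun u : ℝ => 1 / √(1 - u ^ 2)) (Ioo (-1) 1) := by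
  refine (intervalIntegral.integrableOn_deriv_of_nonneg (a := -1) (b := 1) (g := arcsin)
    continuous_arcsin.continuousOn (fun u hu => hasDerivAt_arcsin hu.1.ne' hu.2.ne)
    fun u _ => by positivity).mono_set Ioo_subset_Ioc_self

theorem integrableOn_one_div_sq_mul_sqrt :
    IntegrableOn (fun w : ℝ => 1 / (w ^ 2 * √(1 - 1 / w))) (Ioi 1) := by
  have h := integrableOn_Ioi_deriv_of_nonneg (a := 1) (l := 1) (g := fun w : ℝ => √(1 - w⁻¹))
    (g' := fun w => 1 / 2 * (1 / (w ^ 2 * √(1 - 1 / w)))) ?_ ?_ ?_ ?_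
  · refine (h.const_mul 2).congr (Filter.Eventually.of_forall fun w => ?_)
    ring
  · refine ContinuousAt.continuousWithinAt ?_
    fun_prop (disch := norm_num)
  · intro w hw
    have hw0 : (0 : ℝ) < w := one_pos.trans hw
    have hw1 : 0 < 1 - w⁻¹ := sub_pos.2 (inv_lt_one_of_one_lt₀ hw)
    have := ((hasDerivAt_inv hw0.ne').const_sub 1).sqrt hw1.ne'
    refine this.congr_deriv ?_
    rw [one_div w]
    field_simp
  · intro w _
    positivity
  · have : Filter.Tendsto (fun w : ℝ => √(1 - w⁻¹)) Filter.atTop (nhds √(1 - 0)) :=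
      (tendsto_inv_atTop_zero.const_sub 1).sqrt
    simpa using this

theorem integrableOn_one_div_sq : IntegrableOn (fun w : ℝ => 1 / w ^ 2) (Ioi 1) := by
  have := integrableOn_Ioi_rpow_of_lt (a := -2) (by norm_num) one_pos
  refine this.congr_fun (fun w hw => ?_) measurableSet_Ioi
  have hw0 : (0 : ℝ) < w := one_pos.trans hw
  simp [rpow_neg hw0.le]

theorem exists_lintegralM_le (m : ℕ) {a : ℝ} (ha : 1 < a) : ∃ K : ℝ≥0∞, K ≠ ⊤ ∧
    ∀ b, a ≤ b → lintegralM (m + 3) b ≤ K * ENNReal.ofReal (1 / b ^ (m + 1)) := by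
  have hκ : 0 < 1 - 1 / a := by
    rw [sub_pos, div_lt_one (by linarith)]
    exact ha
  set C := 2 / (1 - 1 / a) ^ (m + 3) with hC
  have hC0 : 0 < C := by positivity
  set A := ∫⁻ w in Ioi (1 : ℝ), ENNReal.ofReal (1 / (w ^ 2 * √(1 - 1 / w))) with hA
  set B := ∫⁻ w in Ioi (1 : ℝ), ENNReal.ofReal (1 / w ^ 2) with hB
  have hAt : A ≠ ⊤ := integrableOn_one_div_sq_mul_sqrt.setLIntegral_lt_top.ne
  have hBt : B ≠ ⊤ := integrableOn_one_div_sq.setLIntegral_lt_top.ne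
  have hDt := integrableOn_one_div_sqrt_one_sub_sq.setLIntegral_lt_top.ne
  refine ⟨ENNReal.ofReal C * ∫⁻ u in Ioo (-1 : ℝ) 1, (A + ENNReal.ofReal (1 / √(1 - u ^ 2)) * B),
    ENNReal.mul_ne_top ENNReal.ofReal_ne_top ?_, fun b hab => ?_⟩
  · rw [lintegral_add_left measurable_const, lintegral_mul_const _ (by fun_prop),
      setLIntegral_const]
    exact ENNReal.add_ne_top.2 ⟨ENNReal.mul_ne_top hAt (by simp), ENNReal.mul_ne_top hDt hBt⟩
  · have hb0 : 0 < b := by linarith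
    rw [mul_right_comm, ← ENNReal.ofReal_mul hC0.le, lintegralM,
      ← lintegral_const_mul' _ _ ENNReal.ofReal_ne_top]
    refine setLIntegral_mono (by fun_prop) fun u hu => ?_
    have := lintegral_Ioi_comp_mul_left hb0 (fun v => ENNReal.ofReal (kernelM (m + 3) b u v)) 1
    rw [mul_one] at this
    rw [this, hA, hB, ← lintegral_const_mul _ (by fun_prop), ← lintegral_add_left (by fun_prop),
      ← lintegral_const_mul _ (by fun_prop)]
    refine setLIntegral_mono (by fun_prop) fun w (hw : 1 < w) => ?_
    have hw0 : 0 < w := by linarith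
    rw [← ENNReal.ofReal_mul hb0.le, ← ENNReal.ofReal_mul (by positivity),
      ← ENNReal.ofReal_add (by positivity) (by positivity), ← ENNReal.ofReal_mul (by positivity)]
    exact ENNReal.ofReal_le_ofReal (kernelM_mul_le ha hab hu hw)

theorem lintegralM_ne_top (m : ℕ) {b : ℝ} (hb : 1 < b) : lintegralM (m + 3) b ≠ ⊤ := by
  obtain ⟨K, hK, h⟩ := exists_lintegralM_le m hb
  exact ne_top_of_le_ne_top (ENNReal.mul_ne_top hK ENNReal.ofReal_ne_top) (h b le_rfl)

/-- The decay of `M` in `b` compensates the singular weight at `r = 1`: `√(1 - r²) * b = √(a² - r²)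
≥ √(a² - 1)`, so the integrand is bounded. -/
theorem lintegral_lintegralM_ne_top (m : ℕ) {a : ℝ} (ha : 1 < a) :
    ∫⁻ r in Ioo (0 : ℝ) 1, ENNReal.ofReal (r ^ m / √(1 - r ^ 2) ^ (m + 1)) *
      lintegralM (m + 3) (paramB a r) ≠ ⊤ := by
  obtain ⟨K, hK, h⟩ := exists_lintegralM_le m ha
  have ha2 : 0 < a ^ 2 - 1 := by nlinarith
  refine ne_top_of_le_ne_top (b := ∫⁻ r in Ioo (0 : ℝ) 1,
    ENNReal.ofReal (1 / √(a ^ 2 - 1) ^ (m + 1)) * K) ?_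
    (setLIntegral_mono measurable_const fun r hr => ?_)
  · rw [setLIntegral_const]
    exact ENNReal.mul_ne_top (ENNReal.mul_ne_top ENNReal.ofReal_ne_top hK) (by simp)
  · have hab := lt_paramB ha hr
    have hb2 := sq_paramB ha hr
    have h1 : 0 < 1 - r ^ 2 := by nlinarith [hr.1, hr.2]
    have hc := sqrt_pos.2 h1
    have hb : 0 < paramB a r := by linarith
    have hcb : √(a ^ 2 - 1) ≤ √(1 - r ^ 2) * paramB a r := by
      rw [sqrt_le_left (by positivity), mul_pow, sq_sqrt h1.le, hb2, mul_div_cancel₀ _ h1.ne']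
      nlinarith [hr.1, hr.2]
    refine (mul_le_mul_right (h _ hab.le) _).trans ?_
    rw [mul_left_comm, mul_comm K, ← ENNReal.ofReal_mul (div_nonneg (pow_nonneg hr.1.le _)
      (by positivity))]
    gcongr
    rw [div_mul_div_comm, mul_one, ← mul_pow]
    have := sqrt_pos.2 ha2
    gcongr
    exact pow_le_one₀ hr.1.le hr.2.le

/-! ### Passage from `[0, ∞]`-valued integrals to real ones -/

theorem integrableOn_kernelM (m : ℕ) {b : ℝ} (hb : 1 < b) :
    IntegrableOn (fun q : ℝ × ℝ => kernelM (m + 3) b q.1 q.2) (Ioo (-1) 1 ×ˢ Ioi b) := by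
  have hm : Measurable fun q : ℝ × ℝ => kernelM (m + 3) b q.1 q.2 :=
    measurable_kernelM_right (m + 3) b
  refine ⟨hm.aestronglyMeasurable, ?_⟩
  rw [hasFiniteIntegral_iff_ofReal]
  · rw [Measure.volume_eq_prod, ← Measure.prod_restrict, lintegral_prod _ (by fun_prop)]
    exact (lintegralM_ne_top m hb).lt_top
  · filter_upwards [ae_restrict_mem (measurableSet_Ioo.prod measurableSet_Ioi)] with q hq
    exact kernelM_nonneg hb hq.1 hq.2

theorem M_eq_toReal (m : ℕ) {b : ℝ} (hb : 1 < b) :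
    M (m + 3) b = (lintegralM (m + 3) b).toReal := by
  have hi := integrableOn_kernelM m hb
  have hm : Measurable fun q : ℝ × ℝ => kernelM (m + 3) b q.1 q.2 :=
    measurable_kernelM_right (m + 3) b
  rw [M, intervalIntegral.integral_of_le (by norm_num), integral_Ioc_eq_integral_Ioo]
  rw [IntegrableOn, Measure.volume_eq_prod, ← Measure.prod_restrict] at hi
  rw [← integral_prod _ hi, integral_eq_lintegral_of_nonneg_ae _ hi.aestronglyMeasurable,
    lintegral_prod _ (by fun_prop)]
  · rfl
  · rw [Measure.prod_restrict]
    filter_upwards [ae_restrict_mem (measurableSet_Ioo.prod measurableSet_Ioi)] with q hq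
    exact kernelM_nonneg hb hq.1 hq.2

/-- The dependence of the domain on `b` is moved into an indicator, so that the integrand is jointly
measurable. -/
theorem measurable_lintegralM (n : ℕ) : Measurable (lintegralM n) := by
  have h : lintegralM n = fun b => ∫⁻ u in Ioo (-1 : ℝ) 1, ∫⁻ v,
      (Ioi b).indicator (fun v => ENNReal.ofReal (kernelM n b u v)) v := by
    funext b
    simp_rw [lintegral_indicator measurableSet_Ioi]
    rfl
  rw [h]
  have hk := measurable_kernelM n
  have hm : Measurable fun q : (ℝ × ℝ) × ℝ =>
      (Ioi q.1.1).indicator (fun v => ENNReal.ofReal (kernelM n q.1.1 q.1.2 v)) q.2 := by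
    have : (fun q : (ℝ × ℝ) × ℝ =>
      (Ioi q.1.1).indicator (fun v => ENNReal.ofReal (kernelM n q.1.1 q.1.2 v)) q.2) =
      {q : (ℝ × ℝ) × ℝ | q.1.1 < q.2}.indicator
        fun q => ENNReal.ofReal (kernelM n q.1.1 q.1.2 q.2) := rfl
    rw [this]
    refine Measurable.indicator ?_ (measurableSet_lt (by fun_prop) (by fun_prop))
    exact (hk.comp (by fun_prop : Measurable fun q : (ℝ × ℝ) × ℝ =>
      (q.1.1, q.1.2, q.2))).ennreal_ofReal
  exact hm.lintegral_prod_right'.lintegral_prod_right'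

theorem one_lt_paramB {a r : ℝ} (ha : 1 < a) (hr : r ∈ Ioo (0 : ℝ) 1) : 1 < paramB a r :=
  ha.trans (lt_paramB ha hr)

theorem integrandR_eq (m : ℕ) {a r : ℝ} (ha : 1 < a) (hr : r ∈ Ioo (0 : ℝ) 1) :
    integrandR (m + 3) a r =
      r ^ m / √(1 - r ^ 2) ^ (m + 1) * (lintegralM (m + 3) (paramB a r)).toReal := by
  rw [← M_eq_toReal m (one_lt_paramB ha hr)]
  rfl

theorem integrandR_nonneg (m : ℕ) {a r : ℝ} (ha : 1 < a) (hr : r ∈ Ioo (0 : ℝ) 1) :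
    0 ≤ integrandR (m + 3) a r := by
  rw [integrandR_eq m ha hr]
  have := hr.1.le
  positivity

theorem ofReal_integrandR (m : ℕ) {a r : ℝ} (ha : 1 < a) (hr : r ∈ Ioo (0 : ℝ) 1) :
    ENNReal.ofReal (integrandR (m + 3) a r) =
      ENNReal.ofReal (r ^ m / √(1 - r ^ 2) ^ (m + 1)) * lintegralM (m + 3) (paramB a r) := by
  have := hr.1.le
  rw [integrandR_eq m ha hr, ENNReal.ofReal_mul (by positivity),
    ENNReal.ofReal_toReal (lintegralM_ne_top m (one_lt_paramB ha hr))]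

theorem lintegral_ofReal_integrandR (m : ℕ) {a : ℝ} (ha : 1 < a) :
    ∫⁻ r in Ioo (0 : ℝ) 1, ENNReal.ofReal (integrandR (m + 3) a r) =
      ∫⁻ r in Ioo (0 : ℝ) 1, ENNReal.ofReal (r ^ m / √(1 - r ^ 2) ^ (m + 1)) *
        lintegralM (m + 3) (paramB a r) :=
  setLIntegral_congr_fun measurableSet_Ioo fun _ hr => ofReal_integrandR m ha hr

theorem integrableOn_integrandR (m : ℕ) {a : ℝ} (ha : 1 < a) :
    IntegrableOn (integrandR (m + 3) a) (Ioo 0 1) := by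
  have hM := measurable_lintegralM (m + 3)
  have hp : Measurable (paramB a) := by
    unfold paramB
    fun_prop
  have hm : Measurable fun r =>
      r ^ m / √(1 - r ^ 2) ^ (m + 1) * (lintegralM (m + 3) (paramB a r)).toReal := by
    fun_prop
  refine ⟨hm.aestronglyMeasurable.congr ?_, ?_⟩
  · filter_upwards [ae_restrict_mem measurableSet_Ioo] with r hr
    exact (integrandR_eq m ha hr).symm
  · rw [hasFiniteIntegral_iff_ofReal, lintegral_ofReal_integrandR m ha]
    · exact (lintegral_lintegralM_ne_top m ha).lt_top
    · filter_upwards [ae_restrict_mem measurableSet_Ioo] with r hr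
      exact integrandR_nonneg m ha hr

theorem integral_integrandR (m : ℕ) {a : ℝ} (ha : 1 < a) :
    ∫ r in Ioo (0 : ℝ) 1, integrandR (m + 3) a r =
      (∫⁻ r in Ioo (0 : ℝ) 1, ENNReal.ofReal (r ^ m / √(1 - r ^ 2) ^ (m + 1)) *
        lintegralM (m + 3) (paramB a r)).toReal := by
  rw [← lintegral_ofReal_integrandR m ha,
    integral_eq_lintegral_of_nonneg_ae _ (integrableOn_integrandR m ha).aestronglyMeasurable]
  filter_upwards [ae_restrict_mem measurableSet_Ioo] with r hr
  exact integrandR_nonneg m ha hr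

/-! ### The substitution `x = paramB a r` -/

theorem hasDerivAt_paramB {a r : ℝ} (ha : 1 < a) (hr : r ∈ Ioo (0 : ℝ) 1) :
    HasDerivAt (paramB a) (r * (a ^ 2 - 1) / ((1 - r ^ 2) ^ 2 * paramB a r)) r := by
  have h1 : 0 < 1 - r ^ 2 := by nlinarith [hr.1, hr.2]
  have h2 : 0 < a ^ 2 - r ^ 2 := by nlinarith
  have hb := one_lt_paramB ha hr
  have hd := ((((hasDerivAt_id r).pow 2).const_sub (a ^ 2)).div
    (((hasDerivAt_id r).pow 2).const_sub 1) h1.ne').sqrt (div_pos h2 h1).ne'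
  refine hd.congr_deriv ?_
  change _ / (2 * paramB a r) = _
  simp only [id, Pi.pow_apply]
  field_simp
  ring

theorem injOn_paramB {a : ℝ} (ha : 1 < a) : InjOn (paramB a) (Ioo 0 1) := by
  intro r hr s hs h
  have h1 : 1 - r ^ 2 ≠ 0 := by nlinarith [hr.1, hr.2]
  have h2 : 1 - s ^ 2 ≠ 0 := by nlinarith [hs.1, hs.2]
  have h3 := sq_paramB ha hr
  rw [h, sq_paramB ha hs, div_eq_div_iff h2 h1] at h3
  have h4 : (a ^ 2 - 1) * (r ^ 2 - s ^ 2) = 0 := by linear_combination -h3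
  have h5 : a ^ 2 - 1 ≠ 0 := by nlinarith
  have h6 := (mul_eq_zero.1 h4).resolve_left h5
  exact (sq_eq_sq₀ hr.1.le hs.1.le).1 (by linarith)

theorem image_paramB {a : ℝ} (ha : 1 < a) : paramB a '' Ioo 0 1 = Ioi a := by
  ext x
  constructor
  · rintro ⟨r, hr, rfl⟩
    exact lt_paramB ha hr
  · intro (hx : a < x)
    have h1 : 0 < x ^ 2 - a ^ 2 := by nlinarith
    have h2 : 0 < x ^ 2 - 1 := by nlinarith
    have h3 : 0 < a ^ 2 - 1 := by nlinarith
    -- The preimage, obtained by solving `x² (1 - r²) = a² - r²` for `r`.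
    have hr : √((x ^ 2 - a ^ 2) / (x ^ 2 - 1)) ∈ Ioo (0 : ℝ) 1 := by
      refine ⟨sqrt_pos.2 (div_pos h1 h2), ?_⟩
      rw [sqrt_lt' one_pos, one_pow, div_lt_one h2]
      linarith
    refine ⟨_, hr, ?_⟩
    have h4 := one_lt_paramB ha hr
    rw [← sq_eq_sq₀ (by linarith) (by linarith), sq_paramB ha hr, sq_sqrt (div_pos h1 h2).le]
    have h5 : 1 - (x ^ 2 - a ^ 2) / (x ^ 2 - 1) = (a ^ 2 - 1) / (x ^ 2 - 1) := by
      field_simp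
      ring
    rw [h5]
    field_simp
    ring

theorem abs_deriv_smul_integrandX (m : ℕ) {a r : ℝ} (ha : 1 < a) (hr : r ∈ Ioo (0 : ℝ) 1) :
    |r * (a ^ 2 - 1) / ((1 - r ^ 2) ^ 2 * paramB a r)| • integrandX (m + 3) a (paramB a r)
      = integrandR (m + 3) a r := by
  have h0 := hr.1
  have h1 : 0 < 1 - r ^ 2 := by nlinarith [hr.1, hr.2]
  have h2 : 0 < a ^ 2 - 1 := by nlinarith
  have hb := one_lt_paramB ha hr
  have hb0 : 0 < paramB a r := by linarith
  have hb2 := sq_paramB ha hr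
  have hR : integrandR (m + 3) a r = r ^ m / √(1 - r ^ 2) ^ (m + 1) * M (m + 3) (paramB a r) := rfl
  have e1 : (paramB a r ^ 2 - a ^ 2) / (a ^ 2 - 1) = r ^ 2 / (1 - r ^ 2) := by
    rw [hb2]
    field_simp
    ring
  have e2 : paramB a r ^ 2 - 1 = (a ^ 2 - 1) / (1 - r ^ 2) := by
    rw [hb2]
    field_simp
    ring
  have hc2 : √(1 - r ^ 2) ^ 2 = 1 - r ^ 2 := sq_sqrt h1.le
  have hc := sqrt_pos.2 h1
  rw [hR, integrandX, e1, e2, smul_eq_mul, abs_of_pos (by positivity)]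
  generalize paramB a r = b at *
  generalize M (m + 3) b = Mb at *
  generalize √(1 - r ^ 2) = c at *
  rw [← hc2] at h1 ⊢
  -- The real exponent `n / 2 - 2` applied to a square gives the integer exponent `m - 1`, which is
  -- `-1` for `n = 3`; hence the quotient instead of a natural power.
  have e3 : (r ^ 2 / c ^ 2) ^ (((m + 3 : ℕ) : ℝ) / 2 - 2) = (r / c) ^ m / (r / c) := by
    have hrc : 0 < r / c := div_pos h0 hc
    rw [← div_pow, ← rpow_natCast (r / c) 2, ← rpow_mul hrc.le]
    have : ((2 : ℕ) : ℝ) * (((m + 3 : ℕ) : ℝ) / 2 - 2) = (m : ℝ) - 1 := by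
      push_cast
      ring
    rw [this, rpow_sub_one hrc.ne', rpow_natCast]
  rw [e3, div_pow]
  field_simp
  ring

theorem integrableOn_integrandX (m : ℕ) {a : ℝ} (ha : 1 < a) :
    IntegrableOn (integrandX (m + 3) a) (Ioi a) := by
  rw [← image_paramB ha, integrableOn_image_iff_integrableOn_abs_deriv_smul measurableSet_Ioo
    (fun r hr => (hasDerivAt_paramB ha hr).hasDerivWithinAt) (injOn_paramB ha)]
  exact (integrableOn_integrandR m ha).congr_fun
    (fun r hr => (abs_deriv_smul_integrandX m ha hr).symm) measurableSet_Ioo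

theorem integral_integrandX (m : ℕ) {a : ℝ} (ha : 1 < a) :
    ∫ x in Ioi a, integrandX (m + 3) a x = ∫ r in Ioo (0 : ℝ) 1, integrandR (m + 3) a r := by
  rw [← image_paramB ha, integral_image_eq_integral_abs_deriv_smul measurableSet_Ioo
    (fun r hr => (hasDerivAt_paramB ha hr).hasDerivWithinAt) (injOn_paramB ha)]
  exact setIntegral_congr_fun measurableSet_Ioo fun r hr => abs_deriv_smul_integrandX m ha hr

/-! ### Assembly of the formulas -/

theorem endpointVolume_crossing_ne_top (m : ℕ) {a : ℝ} (ha : 1 < a) :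
    endpointVolume (m + 3) (crossing (m + 3) a) ≠ ⊤ := by
  rw [endpointVolume_crossing_eq m ha]
  exact ENNReal.mul_ne_top ENNReal.ofNat_ne_top (ENNReal.mul_ne_top
    (ENNReal.mul_ne_top (measure_ne_top _ _) (measure_ne_top _ _))
    (lintegral_lintegralM_ne_top m ha))

theorem toReal_endpointVolume_crossing (m : ℕ) {a : ℝ} (ha : 1 < a) :
    (endpointVolume (m + 3) (crossing (m + 3) a)).toReal = 2 * sphereVol (m + 1) * sphereVol m *
      ∫ r in Ioo (0 : ℝ) 1, integrandR (m + 3) a r := by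
  rw [endpointVolume_crossing_eq m ha, integral_integrandR m ha, ENNReal.toReal_mul,
    ENNReal.toReal_mul, ENNReal.toReal_mul, ENNReal.toReal_ofNat, ← mul_assoc, ← mul_assoc]
  rfl

theorem unitTangentVolume_crossing (m : ℕ) (a : ℝ) :
    unitTangentVolume (m + 3) (crossing (m + 3) a) =
      ENNReal.ofReal (2 ^ (m + 1)) * endpointVolume (m + 3) (crossing (m + 3) a) :=
  congrArg (fun μ : Measure (Amb (m + 3) × Amb (m + 3)) => μ (crossing (m + 3) a))
    (unitTangentVolume_eq (m + 1))

theorem orthoF_endpointVolume (m : ℕ) {l : ℝ} (hl : 0 < l) :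
    orthoF (m + 3) (endpointVolume (m + 3)) l =
      2 * sphereVol (m + 1) * sphereVol m / sphereVol (m + 2) *
        ∫ r in Ioo (0 : ℝ) 1, integrandR (m + 3) (exp l) r := by
  rw [orthoF, toReal_endpointVolume_crossing m (one_lt_exp_iff.2 hl), mul_div_right_comm]
  rfl

theorem orthoF_unitTangentVolume (m : ℕ) {l : ℝ} (hl : 0 < l) :
    orthoF (m + 3) (unitTangentVolume (m + 3)) l =
      2 ^ (m + 2) * sphereVol (m + 1) * sphereVol m / sphereVol (m + 2) *
        ∫ r in Ioo (0 : ℝ) 1, integrandR (m + 3) (exp l) r := by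
  rw [orthoF, unitTangentVolume_crossing, ENNReal.toReal_mul, ENNReal.toReal_ofReal (by positivity),
    toReal_endpointVolume_crossing m (one_lt_exp_iff.2 hl)]
  change _ / sphereVol (m + 2) = _
  ring

end Orthospectrum

end

theorem mainTheorem3 (n : ℕ) (hn : 3 ≤ n) (l a : ℝ) (hl : 0 < l) (ha : a = Real.exp l) :
    -- all integrals converge and all volumes are finite
    (∀ b : ℝ, 1 < b →
      MeasureTheory.IntegrableOn (fun q : ℝ × ℝ => Orthospectrum.kernelM n b q.1 q.2)
        (Set.Ioo (-1) 1 ×ˢ Set.Ioi b)) ∧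
    MeasureTheory.IntegrableOn (Orthospectrum.integrandR n a) (Set.Ioo 0 1) ∧
    MeasureTheory.IntegrableOn (Orthospectrum.integrandX n a) (Set.Ioi a) ∧
    Orthospectrum.unitTangentVolume n (Orthospectrum.crossing n a) ≠ ⊤ ∧
    Orthospectrum.endpointVolume n (Orthospectrum.crossing n a) ≠ ⊤ ∧
    -- the formulas for the Riemannian volume measure
    Orthospectrum.orthoF n (Orthospectrum.unitTangentVolume n) l
      = 2 ^ (n - 1) * Orthospectrum.sphereVol (n - 2) * Orthospectrum.sphereVol (n - 3)
          / Orthospectrum.sphereVol (n - 1)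
        * ∫ r in (0 : ℝ)..1, Orthospectrum.integrandR n a r ∧
    Orthospectrum.orthoF n (Orthospectrum.unitTangentVolume n) l
      = 2 ^ (n - 1) * Orthospectrum.sphereVol (n - 2) * Orthospectrum.sphereVol (n - 3)
          / Orthospectrum.sphereVol (n - 1)
        * ∫ x in Set.Ioi a, Orthospectrum.integrandX n a x ∧
    -- the formulas for the measure `2 dV(x) dV(y) dt / |x - y|^(2n-2)`
    Orthospectrum.orthoF n (Orthospectrum.endpointVolume n) l
      = 2 * Orthospectrum.sphereVol (n - 2) * Orthospectrum.sphereVol (n - 3)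
          / Orthospectrum.sphereVol (n - 1)
        * ∫ r in (0 : ℝ)..1, Orthospectrum.integrandR n a r ∧
    Orthospectrum.orthoF n (Orthospectrum.endpointVolume n) l
      = 2 * Orthospectrum.sphereVol (n - 2) * Orthospectrum.sphereVol (n - 3)
          / Orthospectrum.sphereVol (n - 1)
        * ∫ x in Set.Ioi a, Orthospectrum.integrandX n a x := by
  obtain ⟨m, rfl⟩ := Nat.exists_eq_add_of_le' hn
  subst ha
  have ha : 1 < Real.exp l := Real.one_lt_exp_iff.2 hl
  have hR : ∫ r in (0 : ℝ)..1, Orthospectrum.integrandR (m + 3) (Real.exp l) r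
      = ∫ r in Set.Ioo (0 : ℝ) 1, Orthospectrum.integrandR (m + 3) (Real.exp l) r := by
    rw [intervalIntegral.integral_of_le zero_le_one, MeasureTheory.integral_Ioc_eq_integral_Ioo]
  have h1 := Orthospectrum.orthoF_unitTangentVolume m hl
  have h2 := Orthospectrum.orthoF_endpointVolume m hl
  refine ⟨fun b hb => Orthospectrum.integrableOn_kernelM m hb,
    Orthospectrum.integrableOn_integrandR m ha, Orthospectrum.integrableOn_integrandX m ha, ?_,
    Orthospectrum.endpointVolume_crossing_ne_top m ha, ?_, ?_, ?_, ?_⟩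
  · rw [Orthospectrum.unitTangentVolume_crossing]
    exact ENNReal.mul_ne_top ENNReal.ofReal_ne_top
      (Orthospectrum.endpointVolume_crossing_ne_top m ha)
  · rw [hR]
    exact h1
  · rw [Orthospectrum.integral_integrandX m ha]
    exact h1
  · rw [hR]
    exact h2
  · rw [Orthospectrum.integral_integrandX m ha]
    exact h2
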